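/- Localization Theorem. Let $\mathbf a$ be a set of exactly $\kappa$ regular cardinals (regular cardinals are infinite; $\kappa$ may be any cardinal), with $\lambda>\kappa$ for all $\lambda\in\mathbf a$. For a set $\mathbf x$ of regular cardinals, $\operatorname{pcf}\mathbf x$ denotes the set of all cardinals $\mu$ for which there is an ultrafilter $F$ on $\mathbf x$ such that the ultraproduct $\prod\mathbf x/F$ has cofinality $\mu$; here $\prod\mathbf x=\prod_{\lambda\in\mathbf x}\lambda$, each cardinal is the set of smaller ordinals, functions that agree on a set in $F$ are identified, the ultraproduct is (linearly) ordered by $[f]\le[g]$ iff $\{\lambda\in\mathbf x: f(\lambda)\le g(\lambda)\}\in F$, and its cofinality is the least cardinality of a cofinal subset. Let $\mathbf b\subseteq\operatorname{pcf}\mathbf a$ be such that $\lambda>|\mathbf b|$ for all $\lambda\in\mathbf b$. Then $\operatorname{pcf}\mathbf b\subseteq\operatorname{pcf}\mathbf a$, and for every $\mu\in\operatorname{pcf}\mathbf b$ there is $\mathbf c\subseteq\mathbf b$ with $|\mathbf c|\le\kappa$ and $\mu\in\operatorname{pcf}\mathbf c$. -/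

import Mathlib

open Cardinal

universe u v w

/-- The order of a reduced product `∏ i, X i / F` of ordered sets, read modulo `F`:
`[f] ≤ [g]` if and only if `{i | f i ≤ g i} ∈ F`. -/
instance reducedProductPartialOrder {I : Type v} (F : Filter I) (X : I → Type w)
    [∀ i, PartialOrder (X i)] : PartialOrder (Filter.Product F X) where
  le p q := Quotient.liftOn₂' p q (fun f g => {i | f i ≤ g i} ∈ F) (by
    intro f g f' g' hf hg
    apply propext
    constructor
    · intro h
      filter_upwards [hf, hg, h] with i h1 h2 h3
      change f i ≤ g i at h3
      change f' i ≤ g' i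
      rwa [← h1, ← h2]
    · intro h
      filter_upwards [hf, hg, h] with i h1 h2 h3
      change f' i ≤ g' i at h3
      change f i ≤ g i
      rwa [h1, h2])
  le_refl p := by
    induction p using Quotient.inductionOn' with
    | h f => exact Filter.Eventually.of_forall fun i => le_refl (f i)
  le_trans p q r := by
    induction p using Quotient.inductionOn' with
    | h f =>
      induction q using Quotient.inductionOn' with
      | h g =>
        induction r using Quotient.inductionOn' with
        | h k =>
          intro h1 h2
          change {i | f i ≤ g i} ∈ F at h1
          change {i | g i ≤ k i} ∈ F at h2
          change {i | f i ≤ k i} ∈ F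
          filter_upwards [h1, h2] with i a b
          exact le_trans a b
  le_antisymm p q := by
    induction p using Quotient.inductionOn' with
    | h f =>
      induction q using Quotient.inductionOn' with
      | h g =>
        intro h1 h2
        change {i | f i ≤ g i} ∈ F at h1
        change {i | g i ≤ f i} ∈ F at h2
        apply Quotient.sound'
        filter_upwards [h1, h2] with i a b
        exact le_antisymm a b

/-- The ultraproduct `∏ a / F` of a set `a` of cardinals by an ultrafilter `F` on `a`, where each
cardinal is identified with the set of ordinals below its initial ordinal. -/
abbrev cardinalUltraproduct (a : Set Cardinal.{u}) (F : Ultrafilter a) : Type (u + 1) :=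
  Filter.Product (F : Filter a) (fun i : a => Set.Iio (i : Cardinal.{u}).ord)

/-- `pcf a`, the set of possible cofinalities of `∏ a`: the cardinals that are the cofinality of
`∏ a / F` for some ultrafilter `F` on `a`. (The lift only accounts for universe levels: the set of
all ordinals below a cardinal of universe `u` lives one universe higher.) -/
def pcf (a : Set Cardinal.{u}) : Set Cardinal.{u} :=
  {μ | ∃ F : Ultrafilter a, Order.cof (cardinalUltraproduct a F) = Cardinal.lift.{u + 1} μ}

namespace PcfTheory

open Filter Set

/-! ### Ordinal suprema -/

theorem lift_self (c : Cardinal.{u + 1}) : Cardinal.lift.{u} c = c :=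
  Cardinal.lift_id'.{u, u + 1} c

theorem small_of_mk_lt {ι : Type (u + 1)} {c : Cardinal.{u}}
    (h : #ι < Cardinal.lift.{u + 1} c) : Small.{u} ι := by
  rw [Cardinal.small_iff_lift_mk_lt_univ, Cardinal.lift_id]
  exact h.trans (Cardinal.lift_lt_univ c)

theorem iSup_lt_of_lt_cof {ι : Type (u + 1)} {δ : Ordinal.{u}}
    (h : #ι < Cardinal.lift.{u + 1} δ.cof) (F : ι → Ordinal.{u})
    (hF : ∀ i, F i < δ) : ⨆ i, F i < δ :=
  Ordinal.lift_iSup_lt_of_lt_cof (by rwa [← Ordinal.lift_cof, lift_self]) hF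

theorem exists_bound_of_lt_cof {ι : Type (u + 1)} {δ : Ordinal.{u}}
    (h : #ι < Cardinal.lift.{u + 1} δ.cof) (F : ι → Ordinal.{u})
    (hF : ∀ i, F i < δ) : ∃ o < δ, ∀ i, F i ≤ o :=
  have := small_of_mk_lt h
  ⟨⨆ i, F i, iSup_lt_of_lt_cof h F hF, fun i => Ordinal.le_iSup F i⟩

theorem exists_bound_of_regular {ι : Type (u + 1)} {c : Cardinal.{u}} (hc : c.IsRegular)
    (h : #ι < Cardinal.lift.{u + 1} c) (F : ι → Ordinal.{u})
    (hF : ∀ i, F i < c.ord) : ∃ o < c.ord, ∀ i, F i ≤ o :=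
  exists_bound_of_lt_cof (by rwa [hc.cof_ord]) F hF

theorem mk_Iio_lt {c : Cardinal.{u}} {o : Ordinal.{u}} (h : o < c.ord) :
    #(Iio o) < Cardinal.lift.{u + 1} c := by
  rw [Cardinal.mk_Iio_ordinal]
  exact Cardinal.lift_lt.2 (Cardinal.lt_ord.1 h)

/-- A type of small cardinality is enumerated by an initial ordinal. -/
theorem exists_equiv_Iio {ι : Type (u + 1)} {c : Cardinal.{u}}
    (h : #ι < Cardinal.lift.{u + 1} c) : ∃ ν < c, Nonempty (ι ≃ Iio ν.ord) := by
  obtain ⟨ν, hν⟩ := Cardinal.mem_range_lift_of_le h.le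
  refine ⟨ν, Cardinal.lift_lt.1 (hν ▸ h), Cardinal.eq.1 ?_⟩
  rw [Cardinal.mk_Iio_ordinal, Cardinal.card_ord, hν]

theorem mk_Iio_ord (c : Cardinal.{u}) : #(Iio c.ord) = Cardinal.lift.{u + 1} c := by
  rw [Cardinal.mk_Iio_ordinal, Cardinal.card_ord]

theorem add_one_lt_ord {c : Cardinal.{u}} (hc : ℵ₀ ≤ c) {o : Ordinal.{u}} (h : o < c.ord) :
    o + 1 < c.ord := (Cardinal.isSuccLimit_ord hc).add_one_lt h

/-- A strictly decreasing sequence of traces on `Q` has at most `#Q` terms. -/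
theorem mk_le_of_strict_chain {α : Type v} {ι : Type w} [LinearOrder ι] (Q : Set α)
    (S : ι → Set α)
    (h : ∀ i, ∃ a ∈ Q, a ∈ S i ∧ ∀ j, i < j → a ∉ S j) :
    Cardinal.lift.{v} #ι ≤ Cardinal.lift.{w} #Q := by
  choose a haQ haS ha using h
  refine Cardinal.lift_mk_le'.2 ⟨⟨fun i => ⟨a i, haQ i⟩, fun i j hij => ?_⟩⟩
  have hij : a i = a j := congrArg Subtype.val hij
  rcases lt_trichotomy i j with h | h | h
  · exact absurd (hij ▸ haS j) (ha i j h)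
  · exact h
  · exact absurd (hij ▸ haS i) (ha j i h)

/-! ### Products of cardinals modulo ultrafilters -/

/-- `f` is a member of the product of the cardinals in `Q`. -/
def InProd (Q : Set Cardinal.{u}) (f : Cardinal.{u} → Ordinal.{u}) : Prop :=
  ∀ a ∈ Q, f a < a.ord

/-- `f` is a member of the product of almost all cardinals. -/
def AEInProd (U : Ultrafilter Cardinal.{u}) (f : Cardinal.{u} → Ordinal.{u}) : Prop :=
  ∀ᶠ a in U, f a < a.ord

/-- The product modulo `U` is `lam`-directed. -/
def Directed (U : Ultrafilter Cardinal.{u}) (lam : Cardinal.{u}) : Prop :=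
  ∀ ν < lam, ∀ F : Ordinal.{u} → Cardinal.{u} → Ordinal.{u},
    (∀ ξ < ν.ord, AEInProd U (F ξ)) → ∃ g, AEInProd U g ∧ ∀ ξ < ν.ord, F ξ ≤ᶠ[U] g

/-- `F` enumerates a cofinal subset of the product modulo `U` in type `lam`. -/
def CofinalSeq (U : Ultrafilter Cardinal.{u}) (lam : Cardinal.{u})
    (F : Ordinal.{u} → Cardinal.{u} → Ordinal.{u}) : Prop :=
  (∀ ξ < lam.ord, AEInProd U (F ξ)) ∧ ∀ g, AEInProd U g → ∃ ξ < lam.ord, g ≤ᶠ[U] F ξ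

/-- The product modulo `U` has cofinality `lam`. -/
def HasCof (U : Ultrafilter Cardinal.{u}) (lam : Cardinal.{u}) : Prop :=
  Directed U lam ∧ ∃ F, CofinalSeq U lam F

/-- The possible cofinalities of the product of `Q`, through ultrafilters on all cardinals. -/
def PossCof (Q : Set Cardinal.{u}) : Set Cardinal.{u} :=
  {lam | ∃ U : Ultrafilter Cardinal.{u}, Q ∈ U ∧ HasCof U lam}

/-- `Q` is a set of fewer than `σ` regular cardinals above the regular cardinal `σ`. -/
structure Progressive (σ : Cardinal.{u}) (Q : Set Cardinal.{u}) : Prop where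
  regular : σ.IsRegular
  aleph0_lt : ℵ₀ < σ
  mk_lt : #Q < Cardinal.lift.{u + 1} σ
  mem_regular : ∀ q ∈ Q, q.IsRegular
  lt_mem : ∀ q ∈ Q, σ < q

variable {Q P : Set Cardinal.{u}} {U V : Ultrafilter Cardinal.{u}} {lam μ σ : Cardinal.{u}}

theorem Progressive.mono (h : Progressive σ Q) (hPQ : P ⊆ Q) : Progressive σ P :=
  ⟨h.1, h.2, (Cardinal.mk_le_mk_of_subset hPQ).trans_lt h.3, fun q hq => h.4 q (hPQ hq),
    fun q hq => h.5 q (hPQ hq)⟩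

theorem InProd.mono {f} (h : InProd Q f) (hPQ : P ⊆ Q) : InProd P f := fun a ha => h a (hPQ ha)

theorem InProd.ae {f} (h : InProd Q f) (hQ : Q ∈ U) : AEInProd U f := by
  filter_upwards [hQ] with a ha using h a ha

theorem AEInProd.exists_inProd {f} (h : AEInProd U f) (hQ : ∀ q ∈ Q, q ≠ 0) :
    ∃ g, InProd Q g ∧ f =ᶠ[U] g := by
  classical
  refine ⟨fun a => if f a < a.ord then f a else 0, fun a ha => ?_, ?_⟩
  · dsimp only
    split_ifs with h1
    · exact h1
    · exact Cardinal.ord_pos.2 (pos_iff_ne_zero.2 (hQ a ha))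
  · filter_upwards [h] with a ha
    rw [if_pos ha]

theorem not_le_iff {f g : Cardinal.{u} → Ordinal.{u}} :
    ¬ f ≤ᶠ[U] g ↔ ∀ᶠ a in U, g a < f a := by
  rw [EventuallyLE, ← Ultrafilter.eventually_not]
  simp

theorem le_total' (f g : Cardinal.{u} → Ordinal.{u}) : f ≤ᶠ[U] g ∨ g ≤ᶠ[U] f := by
  by_cases h : f ≤ᶠ[U] g
  · exact Or.inl h
  · exact Or.inr ((not_le_iff.1 h).mono fun a ha => ha.le)

theorem Directed.mono (h : Directed U lam) (hμ : μ ≤ lam) : Directed U μ :=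
  fun ν hν => h ν (hν.trans_le hμ)

/-- Directedness for families over arbitrary index types. -/
theorem Directed.exists_bound (h : Directed U lam) {ι : Type (u + 1)}
    (hι : #ι < Cardinal.lift.{u + 1} lam)
    (F : ι → Cardinal.{u} → Ordinal.{u}) (hF : ∀ i, AEInProd U (F i)) :
    ∃ g, AEInProd U g ∧ ∀ i, F i ≤ᶠ[U] g := by
  classical
  obtain ⟨ν, hν, ⟨e⟩⟩ := exists_equiv_Iio hι
  obtain ⟨g, hg, hle⟩ := h ν hν
    (fun ξ => if hξ : ξ < ν.ord then F (e.symm ⟨ξ, hξ⟩) else fun _ => 0)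
    (fun ξ hξ => by simp only [dif_pos hξ]; exact hF _)
  refine ⟨g, hg, fun i => ?_⟩
  have h1 := hle (e i) (e i).2
  have h2 : (e i).1 < ν.ord := (e i).2
  simp only [dif_pos h2] at h1
  have h3 : (⟨(e i).1, h2⟩ : Iio ν.ord) = e i := rfl
  rwa [h3, e.symm_apply_apply] at h1

theorem AEInProd.max {f g} (hf : AEInProd U f) (hg : AEInProd U g) :
    AEInProd U (fun a => max (f a) (g a)) := by
  filter_upwards [hf, hg] with a h1 h2 using max_lt h1 h2

theorem AEInProd.add_one {f} (hf : AEInProd U f) (hQ : Q ∈ U) (hr : ∀ q ∈ Q, ℵ₀ ≤ q) :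
    AEInProd U (fun a => f a + 1) := by
  filter_upwards [hf, hQ] with a h1 h2 using add_one_lt_ord (hr a h2) h1

theorem not_add_one_le {f g : Cardinal.{u} → Ordinal.{u}} (h : g ≤ᶠ[U] f) :
    ¬ (fun a => f a + 1) ≤ᶠ[U] g := fun h' => by
  obtain ⟨a, h1, h2⟩ := (h.and h').exists
  exact absurd (h2.trans h1) (by simp)

theorem CofinalSeq.le_of_directed {F} (hF : CofinalSeq U lam F) (hd : Directed U μ)
    (hQ : Q ∈ U) (hr : ∀ q ∈ Q, ℵ₀ ≤ q) : μ ≤ lam := by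
  by_contra! hlt
  obtain ⟨g, hg, hle⟩ := hd lam hlt F hF.1
  obtain ⟨ξ, hξ, h⟩ := hF.2 _ (hg.add_one hQ hr)
  exact not_add_one_le (hle ξ hξ) h

theorem HasCof.le_of_directed (h : HasCof U lam) (hd : Directed U μ)
    (hQ : Q ∈ U) (hr : ∀ q ∈ Q, ℵ₀ ≤ q) : μ ≤ lam :=
  h.2.choose_spec.le_of_directed hd hQ hr

theorem HasCof.unique (h : HasCof U lam) (h' : HasCof U μ) (hQ : Q ∈ U) (hr : ∀ q ∈ Q, ℵ₀ ≤ q) :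
    lam = μ :=
  le_antisymm (h'.le_of_directed h.1 hQ hr) (h.le_of_directed h'.1 hQ hr)

theorem directed_aleph0 (hQ : Q ∈ U) (hr : ∀ q ∈ Q, ℵ₀ ≤ q) : Directed U ℵ₀ := by
  intro ν hν F hF
  have hfin : Finite (Iio ν.ord) := by
    rw [← Cardinal.lt_aleph0_iff_finite, mk_Iio_ord]
    exact Cardinal.lift_lt_aleph0.2 hν
  refine ⟨fun a => ⨆ ξ : Iio ν.ord, F ξ a, ?_, fun ξ hξ => ?_⟩
  · have : ∀ᶠ a in U, ∀ ξ : Iio ν.ord, F ξ a < a.ord := eventually_all.2 fun ξ => hF ξ ξ.2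
    filter_upwards [this, hQ] with a ha haQ
    refine iSup_lt_of_lt_cof ?_ _ ha
    have h1 : ℵ₀ ≤ a.ord.cof := Ordinal.aleph0_le_cof_iff.2
      (Ordinal.one_lt_cof_iff.2 (Cardinal.isSuccLimit_ord (hr a haQ)))
    exact (Cardinal.lt_aleph0_iff_finite.2 hfin).trans_le (Cardinal.aleph0_le_lift.2 h1)
  · exact Eventually.of_forall fun a =>
      Ordinal.le_iSup (fun ξ : Iio ν.ord => F ξ a) ⟨ξ, hξ⟩

theorem HasCof.regular (h : HasCof U lam) (hQ : Q ∈ U) (hr : ∀ q ∈ Q, ℵ₀ ≤ q) :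
    lam.IsRegular := by
  have hinf : ℵ₀ ≤ lam := h.le_of_directed (directed_aleph0 hQ hr) hQ hr
  obtain ⟨F, hF⟩ := h.2
  refine ⟨hinf, ?_⟩
  by_contra! hlt
  obtain ⟨S, hS, hSc⟩ := Order.exists_cof_eq (Iio lam.ord)
  have hSc' : #S < Cardinal.lift.{u + 1} lam := by
    rw [hSc, Ordinal.cof_Iio, ← Ordinal.lift_cof]
    exact Cardinal.lift_lt.2 hlt
  have hb : ∀ η : S, ∃ g, AEInProd U g ∧ ∀ ξ : Iio η.1.1, F ξ ≤ᶠ[U] g := fun η =>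
    h.1.exists_bound (mk_Iio_lt η.1.2) (fun ξ => F ξ) fun ξ => hF.1 _ (ξ.2.trans η.1.2)
  choose g hg hle using hb
  obtain ⟨k, hk, hkle⟩ := h.1.exists_bound (ι := S) hSc' g hg
  obtain ⟨ξ, hξ, hle'⟩ := hF.2 _ (hk.add_one hQ hr)
  obtain ⟨η, hη, hξη⟩ := hS ⟨ξ + 1, add_one_lt_ord hinf hξ⟩
  have hlt' : ξ < η.1 := lt_of_lt_of_le (Order.lt_add_one_iff.2 le_rfl) hξη
  exact not_add_one_le ((hle ⟨η, hη⟩ ⟨ξ, hlt'⟩).trans (hkle ⟨η, hη⟩)) hle'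

/-- Modulo an ultrafilter containing a small set the cofinality exists. -/
theorem exists_hasCof (hQ : Q ∈ U) (hs : Small.{u} Q) (hz : ∀ q ∈ Q, q ≠ 0) :
    ∃ lam, HasCof U lam := by
  classical
  have hne : {lam : Cardinal.{u} | ∃ F, CofinalSeq U lam F}.Nonempty := by
    have : Small.{u} ((q : Q) → Iio q.1.ord) := small_Pi _
    obtain ⟨c, hc⟩ : ∃ c : Cardinal.{u}, #((q : Q) → Iio q.1.ord) < Cardinal.lift.{u + 1} c := by
      have h1 := Cardinal.small_iff_lift_mk_lt_univ.1 this
      rw [Cardinal.lift_id] at h1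
      obtain ⟨c, hc⟩ := Cardinal.lt_univ.1 h1
      exact ⟨Order.succ c, by rw [hc]; exact Cardinal.lift_lt.2 (Order.lt_succ c)⟩
    obtain ⟨ν, -, ⟨e⟩⟩ := exists_equiv_Iio hc
    refine ⟨ν, fun ξ a => if h : ξ < ν.ord ∧ a ∈ Q then (e.symm ⟨ξ, h.1⟩ ⟨a, h.2⟩).1 else 0,
      ?_, ?_⟩
    · intro ξ hξ
      filter_upwards [hQ] with a ha
      rw [dif_pos ⟨hξ, ha⟩]
      exact (e.symm ⟨ξ, hξ⟩ ⟨a, ha⟩).2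
    · intro g hg
      obtain ⟨g', hg', hgg⟩ := hg.exists_inProd hz
      refine ⟨(e fun q => ⟨g' q.1, hg' q.1 q.2⟩).1, (e fun q => ⟨g' q.1, hg' q.1 q.2⟩).2, ?_⟩
      filter_upwards [hgg, hQ] with a h1 ha
      rw [dif_pos ⟨(e fun q => ⟨g' q.1, hg' q.1 q.2⟩).2, ha⟩]
      change g a ≤ (e.symm (e fun q => ⟨g' q.1, hg' q.1 q.2⟩) ⟨a, ha⟩).1
      rw [e.symm_apply_apply]
      exact h1.le
  refine ⟨sInf {lam : Cardinal.{u} | ∃ F, CofinalSeq U lam F}, ?_, csInf_mem hne⟩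
  intro ν hν F hF
  by_contra! hcon
  refine notMem_of_lt_csInf' hν ⟨F, hF, fun g hg => ?_⟩
  obtain ⟨ξ, hξ, h⟩ := hcon g hg
  exact ⟨ξ, hξ, (le_total' _ _).resolve_left h⟩

/-- Construction of a transfinite sequence by recursion from a step relation. -/
theorem exists_seq {X : Type w} [Inhabited X] (R : Ordinal.{u} → (Ordinal.{u} → X) → X → Prop)
    (hcongr : ∀ ξ F G x, (∀ η < ξ, F η = G η) → R ξ F x → R ξ G x)
    (hstep : ∀ ξ F, (∀ η < ξ, R η F (F η)) → ∃ x, R ξ F x) :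
    ∃ f : Ordinal.{u} → X, ∀ ξ, R ξ f (f ξ) := by
  classical
  let ext (ξ : Ordinal.{u}) (F : ∀ η, η < ξ → X) : Ordinal.{u} → X :=
    fun η => if h : η < ξ then F η h else default
  let f : Ordinal.{u} → X := WellFounded.fix (C := fun _ => X) Ordinal.lt_wf
    fun ξ F => if h : ∃ x, R ξ (ext ξ F) x then h.choose else default
  have hf : ∀ ξ, (∃ x, R ξ (ext ξ fun η _ => f η) x) → R ξ (ext ξ fun η _ => f η) (f ξ) := by
    intro ξ h
    have : f ξ = h.choose := by
      change WellFounded.fix _ _ _ = _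
      rw [WellFounded.fix_eq]
      exact dif_pos h
    rw [this]
    exact h.choose_spec
  have hext : ∀ ξ, ∀ η < ξ, ext ξ (fun η _ => f η) η = f η := fun ξ η h => dif_pos h
  refine ⟨f, fun ξ => ?_⟩
  induction ξ using WellFoundedLT.induction with
  | ind ξ ih =>
    obtain ⟨x, hx⟩ := hstep ξ f ih
    exact hcongr _ _ _ _ (hext ξ) (hf ξ ⟨x, hcongr _ _ _ _ (fun η h => (hext ξ η h).symm) hx⟩)

/-- `f ≤ g` modulo all ultrafilters whose product is `lam`-directed. -/
def LeMod (Q : Set Cardinal.{u}) (lam : Cardinal.{u}) (f g : Cardinal.{u} → Ordinal.{u}) : Prop :=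
  ∀ U : Ultrafilter Cardinal.{u}, Q ∈ U → Directed U lam → f ≤ᶠ[U] g

theorem LeMod.trans {f g h} (h1 : LeMod Q lam f g) (h2 : LeMod Q lam g h) : LeMod Q lam f h :=
  fun U hU hd => (h1 U hU hd).trans (h2 U hU hd)

theorem le_of_forall {f g : Cardinal.{u} → Ordinal.{u}} (hU : Q ∈ U) (h : ∀ a ∈ Q, f a ≤ g a) :
    f ≤ᶠ[U] g := by
  filter_upwards [hU] with a ha using h a ha

theorem leMod_of_forall {f g : Cardinal.{u} → Ordinal.{u}} (h : ∀ a ∈ Q, f a ≤ g a) :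
    LeMod Q lam f g := fun _ hU _ => le_of_forall hU h

namespace Progressive

variable (hQ : Progressive σ Q)
include hQ

theorem ne_zero (q) (h : q ∈ Q) : q ≠ 0 := (hQ.mem_regular q h).ne_zero

theorem aleph0_le (q) (h : q ∈ Q) : ℵ₀ ≤ q := (hQ.mem_regular q h).1

theorem small : Small.{u} Q := small_of_mk_lt hQ.mk_lt

/-- Pointwise suprema of at most `σ` functions. -/
theorem inProd_iSup {ι : Type (u + 1)} (hι : #ι ≤ Cardinal.lift.{u + 1} σ)
    (F : ι → Cardinal.{u} → Ordinal.{u}) (hF : ∀ i, InProd Q (F i)) :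
    InProd Q (fun a => ⨆ i, F i a) ∧ ∀ i a, F i a ≤ ⨆ j, F j a := by
  have hs : Small.{u} ι := small_of_mk_lt (hι.trans_lt (Cardinal.lift_lt.2 (Order.lt_succ σ)))
  refine ⟨fun a ha => ?_, fun i a => Ordinal.le_iSup (fun i => F i a) i⟩
  refine iSup_lt_of_lt_cof ?_ _ fun i => hF i a ha
  rw [(hQ.mem_regular a ha).cof_ord]
  exact hι.trans_lt (Cardinal.lift_lt.2 (hQ.lt_mem a ha))

omit hQ in
theorem inProd_max {f g} (hf : InProd Q f) (hg : InProd Q g) :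
    InProd Q (fun a => max (f a) (g a)) := fun a ha => max_lt (hf a ha) (hg a ha)

theorem inProd_add_one {f} (hf : InProd Q f) : InProd Q (fun a => f a + 1) :=
  fun a ha => add_one_lt_ord (hQ.aleph0_le a ha) (hf a ha)

omit hQ in
/-- Increasing majorants of sequences. -/
theorem exists_increasing {δ : Ordinal.{u}} (lam : Cardinal.{u})
    (hb : ∀ ξ < δ, ∀ F : Ordinal.{u} → Cardinal.{u} → Ordinal.{u}, (∀ η < ξ, InProd Q (F η)) →
      ∃ g, InProd Q g ∧ ∀ η < ξ, LeMod Q lam (F η) g)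
    (k : Ordinal.{u} → Cardinal.{u} → Ordinal.{u}) (hk : ∀ ξ < δ, InProd Q (k ξ)) :
    ∃ f : Ordinal.{u} → Cardinal.{u} → Ordinal.{u}, (∀ ξ < δ, InProd Q (f ξ)) ∧
      (∀ ξ < δ, ∀ a ∈ Q, k ξ a ≤ f ξ a) ∧ ∀ ξ < δ, ∀ η < ξ, LeMod Q lam (f η) (f ξ) := by
  obtain ⟨f, hf⟩ := exists_seq (X := Cardinal.{u} → Ordinal.{u})
    (fun ξ F x => ξ < δ → InProd Q x ∧ (∀ a ∈ Q, k ξ a ≤ x a) ∧ ∀ η < ξ, LeMod Q lam (F η) x)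
    (fun ξ F G x hFG h hξ => by
      obtain ⟨h1, h2, h3⟩ := h hξ
      exact ⟨h1, h2, fun η hη => hFG η hη ▸ h3 η hη⟩)
    (fun ξ F hF => by
      by_cases hξ : ξ < δ
      · obtain ⟨g, hg, hle⟩ := hb ξ hξ F fun η hη => (hF η hη (hη.trans hξ)).1
        exact ⟨_, fun _ => ⟨inProd_max (hk ξ hξ) hg, fun a _ => le_max_left _ _, fun η hη =>
          (hle η hη).trans (leMod_of_forall fun a _ => le_max_right _ _)⟩⟩
      · exact ⟨default, fun h => absurd h hξ⟩)
  exact ⟨f, fun ξ hξ => (hf ξ hξ).1, fun ξ hξ => (hf ξ hξ).2.1, fun ξ hξ => (hf ξ hξ).2.2⟩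

/-- Fewer than `lam` functions have a common bound modulo all `lam`-directed ultrafilters. -/
theorem exists_leMod_bound_ord (lam : Cardinal.{u}) : ∀ m < lam,
    ∀ F : Ordinal.{u} → Cardinal.{u} → Ordinal.{u}, (∀ ξ < m.ord, InProd Q (F ξ)) →
      ∃ g, InProd Q g ∧ ∀ ξ < m.ord, LeMod Q lam (F ξ) g := by
  intro m
  induction m using WellFoundedLT.induction with
  | ind m ih =>
  intro hm F hF
  have hb : ∀ ξ < m.ord, ∀ F : Ordinal.{u} → Cardinal.{u} → Ordinal.{u},
      (∀ η < ξ, InProd Q (F η)) → ∃ g, InProd Q g ∧ ∀ η < ξ, LeMod Q lam (F η) g := by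
    intro ξ hξ F hF
    classical
    have hc : ξ.card < m := Cardinal.lt_ord.1 hξ
    have hmk : #(Iio ξ) = #(Iio ξ.card.ord) := by
      rw [mk_Iio_ord, Cardinal.mk_Iio_ordinal]
    obtain ⟨e⟩ := Cardinal.eq.1 hmk
    obtain ⟨g, hg, hle⟩ := ih ξ.card hc (hc.trans hm)
      (fun η => if h : η < ξ.card.ord then F (e.symm ⟨η, h⟩) else fun _ => 0)
      (fun η hη => by simp only [dif_pos hη]; exact hF _ (e.symm ⟨η, hη⟩).2)
    refine ⟨g, hg, fun η hη => ?_⟩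
    have h1 := hle (e ⟨η, hη⟩) (e ⟨η, hη⟩).2
    have h2 : (e ⟨η, hη⟩).1 < ξ.card.ord := (e ⟨η, hη⟩).2
    simp only [dif_pos h2] at h1
    have h3 : (⟨(e ⟨η, hη⟩).1, h2⟩ : Iio ξ.card.ord) = e ⟨η, hη⟩ := rfl
    rwa [h3, e.symm_apply_apply] at h1
  obtain ⟨f, hf, hFf, hinc⟩ := exists_increasing lam hb F hF
  suffices h : ∃ g, InProd Q g ∧ ∀ ξ < m.ord, LeMod Q lam (f ξ) g by
    obtain ⟨g, hg, hle⟩ := h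
    exact ⟨g, hg, fun ξ hξ => (leMod_of_forall (hFf ξ hξ)).trans (hle ξ hξ)⟩
  rcases le_or_gt m.ord.cof σ with hcof | hcof
  · obtain ⟨S, hS, hSc⟩ := Order.exists_cof_eq (Iio m.ord)
    have hSc' : #S ≤ Cardinal.lift.{u + 1} σ := by
      rw [hSc, Ordinal.cof_Iio, ← Ordinal.lift_cof]
      exact Cardinal.lift_le.2 hcof
    obtain ⟨h1, h2⟩ := hQ.inProd_iSup hSc' (fun s => f s.1.1) fun s => hf _ s.1.2
    refine ⟨_, h1, fun ξ hξ => ?_⟩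
    obtain ⟨s, hs, hle⟩ := hS ⟨ξ, hξ⟩
    refine LeMod.trans ?_ (leMod_of_forall fun a _ => h2 ⟨s, hs⟩ a)
    rcases (show ξ ≤ s.1 from hle).lt_or_eq with h3 | h3
    · exact hinc _ s.2 _ h3
    · rw [h3]
      exact leMod_of_forall fun a _ => le_rfl
  · by_contra! hcon
    have hcon' : ∀ g, InProd Q g → ∃ ξ < m.ord, ∃ U : Ultrafilter Cardinal.{u}, Q ∈ U ∧
        Directed U lam ∧ (∀ᶠ a in U, g a < f ξ a) ∧
          ∃ h, InProd Q h ∧ ∀ η < m.ord, f η ≤ᶠ[U] h := by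
      intro g hg
      obtain ⟨ξ, hξ, hno⟩ := hcon g hg
      simp only [LeMod, not_forall] at hno
      obtain ⟨U, hU, hd, hno⟩ := hno
      refine ⟨ξ, hξ, U, hU, hd, not_le_iff.1 hno, ?_⟩
      obtain ⟨h, hh, hle⟩ := hd m hm f fun η hη => (hf η hη).ae hU
      obtain ⟨h', hh', heq⟩ := hh.exists_inProd hQ.ne_zero
      exact ⟨h', hh', fun η hη => (hle η hη).trans heq.le⟩
    choose! ξ hξ U hU hd hlt h hh hle using hcon'
    obtain ⟨g, hg⟩ := exists_seq (X := Cardinal.{u} → Ordinal.{u})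
      (fun α F x => α < σ.ord → InProd Q x ∧ ∀ β < α, ∀ a ∈ Q, h (F β) a ≤ x a)
      (fun α F G x hFG h hα => by
        obtain ⟨h1, h2⟩ := h hα
        exact ⟨h1, fun β hβ => hFG β hβ ▸ h2 β hβ⟩)
      (fun α F hF => by
        by_cases hα : α < σ.ord
        · obtain ⟨h1, h2⟩ := hQ.inProd_iSup (mk_Iio_lt hα).le
            (fun β : Iio α => h (F β)) fun β => hh _ (hF β β.2 (β.2.trans hα)).1
          exact ⟨_, fun _ => ⟨h1, fun β hβ a _ => h2 ⟨β, hβ⟩ a⟩⟩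
        · exact ⟨default, fun h => absurd h hα⟩)
    obtain ⟨ξs, hξs, hξle⟩ := exists_bound_of_lt_cof (δ := m.ord) (ι := Iio σ.ord)
      (by rw [mk_Iio_ord]; exact Cardinal.lift_lt.2 hcof) (fun α => ξ (g α))
      fun α => hξ _ (hg α α.2).1
    refine absurd hQ.mk_lt (not_lt.2 ?_)
    have := mk_le_of_strict_chain (ι := Iio σ.ord) Q (fun α => {a | g α a < f ξs a}) ?_
    · simpa [mk_Iio_ord] using this
    intro α
    have hgα := (hg α α.2).1
    have h1 : f (ξ (g α)) ≤ᶠ[U (g α)] f ξs := by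
      rcases (hξle α).lt_or_eq with h3 | h3
      · exact hinc _ hξs _ h3 _ (hU _ hgα) (hd _ hgα)
      · rw [h3]
    have h2 := hle _ hgα ξs hξs
    have h3 : ∀ᶠ a in U (g α), a ∈ Q := hU _ hgα
    obtain ⟨a, ⟨h4, h5⟩, h6, h7⟩ := ((h1.and h2).and (h3.and (hlt _ hgα))).exists
    refine ⟨a, h6, h7.trans_le h4, fun β hβ => ?_⟩
    exact not_lt.2 (h5.trans ((hg β β.2).2 α hβ a h6))

theorem exists_leMod_bound {lam : Cardinal.{u}} {ι : Type (u + 1)}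
    (hι : #ι < Cardinal.lift.{u + 1} lam)
    (F : ι → Cardinal.{u} → Ordinal.{u}) (hF : ∀ i, InProd Q (F i)) :
    ∃ g, InProd Q g ∧ ∀ i, LeMod Q lam (F i) g := by
  classical
  obtain ⟨ν, hν, ⟨e⟩⟩ := exists_equiv_Iio hι
  obtain ⟨g, hg, hle⟩ := hQ.exists_leMod_bound_ord lam ν hν
    (fun ξ => if hξ : ξ < ν.ord then F (e.symm ⟨ξ, hξ⟩) else fun _ => 0)
    (fun ξ hξ => by simp only [dif_pos hξ]; exact hF _)
  refine ⟨g, hg, fun i => ?_⟩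
  have h1 := hle (e i) (e i).2
  have h2 : (e i).1 < ν.ord := (e i).2
  simp only [dif_pos h2] at h1
  have h3 : (⟨(e i).1, h2⟩ : Iio ν.ord) = e i := rfl
  rwa [h3, e.symm_apply_apply] at h1

theorem directed_of_forall_mem (hU : Q ∈ U)
    (h : ∀ S ∈ U, ∃ V : Ultrafilter Cardinal.{u}, S ∈ V ∧ Q ∈ V ∧ Directed V lam) :
    Directed U lam := by
  intro ν hν F hF
  have hF' : ∀ ξ : Iio ν.ord, ∃ f, InProd Q f ∧ F ξ =ᶠ[U] f :=
    fun ξ => (hF ξ ξ.2).exists_inProd hQ.ne_zero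
  choose f hf hFf using hF'
  obtain ⟨g, hg, hle⟩ := hQ.exists_leMod_bound (ι := Iio ν.ord)
    (by rw [mk_Iio_ord]; exact Cardinal.lift_lt.2 hν) f hf
  refine ⟨g, hg.ae hU, fun ξ hξ => (hFf ⟨ξ, hξ⟩).le.trans ?_⟩
  by_contra hno
  obtain ⟨V, hSV, hQV, hd⟩ := h _ (not_le_iff.1 hno)
  obtain ⟨a, h1, h2⟩ := ((hle ⟨ξ, hξ⟩ V hQV hd).and hSV).exists
  exact absurd h1 (not_le.2 h2)

/-- A limit of ultrafilters along a directed family of conditions. -/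
theorem exists_limit_ultrafilter {ι : Type v} [Nonempty ι] (l : ι → Cardinal.{u})
    (R : ι → Set Cardinal.{u})
    (hdir : ∀ i j, ∃ k, ∀ V : Ultrafilter Cardinal.{u}, Q ∈ V → Directed V (l k) → R k ∈ V →
      (Directed V (l i) ∧ R i ∈ V) ∧ Directed V (l j) ∧ R j ∈ V)
    (hne : ∀ i, ∃ V : Ultrafilter Cardinal.{u}, Q ∈ V ∧ Directed V (l i) ∧ R i ∈ V) :
    ∃ U : Ultrafilter Cardinal.{u}, Q ∈ U ∧ ∀ i, Directed U (l i) ∧ R i ∈ U := by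
  let G : Filter Cardinal.{u} :=
    { sets := {S | ∃ i, ∀ V : Ultrafilter Cardinal.{u}, Q ∈ V → Directed V (l i) → R i ∈ V → S ∈ V}
      univ_sets := ⟨Classical.arbitrary ι, fun V _ _ _ => univ_mem⟩
      sets_of_superset := fun ⟨i, hi⟩ hST => ⟨i, fun V h1 h2 h3 =>
        mem_of_superset (hi V h1 h2 h3) hST⟩
      inter_sets := by
        rintro S T ⟨i, hi⟩ ⟨j, hj⟩
        obtain ⟨k, hk⟩ := hdir i j
        refine ⟨k, fun V h1 h2 h3 => ?_⟩
        obtain ⟨⟨h4, h5⟩, h6, h7⟩ := hk V h1 h2 h3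
        exact inter_mem (hi V h1 h4 h5) (hj V h1 h6 h7) }
  have hG : ∀ S, S ∈ G ↔ ∃ i, ∀ V : Ultrafilter Cardinal.{u}, Q ∈ V → Directed V (l i) →
      R i ∈ V → S ∈ V := fun S => Iff.rfl
  have hGne : NeBot G := by
    refine ⟨fun h => ?_⟩
    obtain ⟨i, hi⟩ := (hG ∅).1 (h ▸ mem_bot)
    obtain ⟨V, h1, h2, h3⟩ := hne i
    exact V.empty_notMem (hi V h1 h2 h3)
  obtain ⟨U, hU⟩ := Ultrafilter.exists_le G
  have hQU : Q ∈ U := hU ((hG Q).2 ⟨Classical.arbitrary ι, fun V h _ _ => h⟩)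
  refine ⟨U, hQU, fun i => ⟨?_, hU ((hG _).2 ⟨i, fun V _ _ h => h⟩)⟩⟩
  refine hQ.directed_of_forall_mem hQU fun S hS => ?_
  by_contra! hno
  have : Sᶜ ∈ U := hU ((hG _).2 ⟨i, fun V h1 h2 _ => by
    by_contra h3
    exact hno V (Ultrafilter.compl_notMem_iff.1 h3) h1 h2⟩)
  exact Ultrafilter.compl_notMem_iff.2 hS this

omit hQ in
theorem possCof_mono (h : P ⊆ Q) : PossCof P ⊆ PossCof Q :=
  fun _ ⟨U, hU, hc⟩ => ⟨U, mem_of_superset hU h, hc⟩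

theorem possCof_regular (h : lam ∈ PossCof Q) : lam.IsRegular :=
  let ⟨_, hU, hc⟩ := h
  hc.regular hU hQ.aleph0_le

theorem possCof_nonempty (hne : Q.Nonempty) : (PossCof Q).Nonempty := by
  obtain ⟨q, hq⟩ := hne
  obtain ⟨lam, h⟩ := exists_hasCof (U := pure q) (Ultrafilter.mem_pure.2 hq) hQ.small hQ.ne_zero
  exact ⟨lam, _, Ultrafilter.mem_pure.2 hq, h⟩

theorem directed_succ (hU : Q ∈ U) : Directed U (Order.succ σ) := by
  intro ν hν F hF
  have hF' : ∀ ξ : Iio ν.ord, ∃ f, InProd Q f ∧ F ξ =ᶠ[U] f :=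
    fun ξ => (hF ξ ξ.2).exists_inProd hQ.ne_zero
  choose f hf hFf using hF'
  obtain ⟨h1, h2⟩ := hQ.inProd_iSup (by
    rw [mk_Iio_ord]; exact Cardinal.lift_le.2 (Order.lt_succ_iff.1 hν)) f hf
  exact ⟨_, h1.ae hU, fun ξ hξ => (hFf ⟨ξ, hξ⟩).le.trans
    (Eventually.of_forall fun a => h2 ⟨ξ, hξ⟩ a)⟩

theorem lt_possCof (h : lam ∈ PossCof Q) : σ < lam :=
  let ⟨_, hU, hc⟩ := h
  Order.succ_le_iff.1 (hc.le_of_directed (hQ.directed_succ hU) hU hQ.aleph0_le)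

/-- There is a largest possible cofinality. -/
theorem exists_max_possCof (hne : Q.Nonempty) : ∃ lam ∈ PossCof Q, ∀ μ ∈ PossCof Q, μ ≤ lam := by
  have : Nonempty (PossCof Q) := (hQ.possCof_nonempty hne).to_subtype
  obtain ⟨U, hU, h⟩ := hQ.exists_limit_ultrafilter (ι := PossCof Q) (fun i => i.1)
    (fun _ => univ) (fun i j => by
      rcases le_total i.1 j.1 with h | h
      · exact ⟨j, fun V _ hd _ => ⟨⟨hd.mono h, univ_mem⟩, hd, univ_mem⟩⟩
      · exact ⟨i, fun V _ hd _ => ⟨⟨hd, univ_mem⟩, hd.mono h, univ_mem⟩⟩)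
    (fun i => by
      obtain ⟨V, h1, h2⟩ := i.2
      exact ⟨V, h1, h2.1, univ_mem⟩)
  obtain ⟨lam, hlam⟩ := exists_hasCof hU hQ.small hQ.ne_zero
  exact ⟨lam, ⟨U, hU, hlam⟩, fun μ hμ =>
    hlam.le_of_directed (h ⟨μ, hμ⟩).1 hU hQ.aleph0_le⟩

/-- An ultrafilter of cofinality less than `μ` contains a set with all cofinalities below `μ`. -/
theorem exists_mem_not_directed (hU : Q ∈ U) (h : HasCof U lam) (hlt : lam < μ) :
    ∃ Z ∈ U, ∀ V : Ultrafilter Cardinal.{u}, Z ∈ V → Q ∈ V → ¬ Directed V μ := by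
  by_contra! hcon
  exact absurd (h.le_of_directed (hQ.directed_of_forall_mem hU hcon) hU hQ.aleph0_le)
    (not_le.2 hlt)

omit hQ in
theorem lt_of_not_directed (h : HasCof U lam) (hd : ¬ Directed U μ) : lam < μ := by
  by_contra! hle
  exact hd (h.1.mono hle)

/-- Scales modulo an ultrafilter. -/
theorem exists_scale (hU : Q ∈ U) (h : HasCof U lam) :
    ∃ f : Ordinal.{u} → Cardinal.{u} → Ordinal.{u}, (∀ ξ < lam.ord, InProd Q (f ξ)) ∧
      (∀ ξ < lam.ord, ∀ η ≤ ξ, f η ≤ᶠ[U] f ξ) ∧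
        ∀ g, AEInProd U g → ∃ ξ < lam.ord, g ≤ᶠ[U] f ξ := by
  obtain ⟨hd, F, hF, hcof⟩ := h
  obtain ⟨f, hf⟩ := exists_seq (X := Cardinal.{u} → Ordinal.{u})
    (fun ξ f x => ξ < lam.ord → InProd Q x ∧ F ξ ≤ᶠ[U] x ∧ ∀ η < ξ, f η ≤ᶠ[U] x)
    (fun ξ F G x hFG h hξ => by
      obtain ⟨h1, h2, h3⟩ := h hξ
      exact ⟨h1, h2, fun η hη => hFG η hη ▸ h3 η hη⟩)
    (fun ξ f hf => by
      by_cases hξ : ξ < lam.ord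
      · obtain ⟨g, hg, hle⟩ := hd.exists_bound (mk_Iio_lt hξ) (fun η : Iio ξ => f η)
          fun η => (hf η η.2 (η.2.trans hξ)).1.ae hU
        obtain ⟨g', hg', heq⟩ := (hg.max (hF ξ hξ)).exists_inProd hQ.ne_zero
        refine ⟨g', fun _ => ⟨hg', ?_, fun η hη => (hle ⟨η, hη⟩).trans ?_⟩⟩
        · filter_upwards [heq] with a ha using (le_max_right _ _).trans ha.le
        · filter_upwards [heq] with a ha using (le_max_left _ _).trans ha.le
      · exact ⟨default, fun h => absurd h hξ⟩)
  refine ⟨f, fun ξ hξ => (hf ξ hξ).1, fun ξ hξ η hη => ?_, fun g hg => ?_⟩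
  · rcases hη.lt_or_eq with h | h
    · exact (hf ξ hξ).2.2 η h
    · rw [h]
  · obtain ⟨ξ, hξ, hle⟩ := hcof g hg
    exact ⟨ξ, hξ, hle.trans (hf ξ hξ).2.1⟩

end Progressive

/-! ### Iterated cofinalities -/

theorem Progressive.hasCof_bind (hQ : Progressive σ Q) {B : Set Cardinal.{u}}
    {D : Ultrafilter Cardinal.{u}} {F : Cardinal.{u} → Ultrafilter Cardinal.{u}}
    (hF : ∀ θ ∈ B, Q ∈ F θ ∧ HasCof (F θ) θ) (hB : ∀ θ ∈ B, #B < Cardinal.lift.{u + 1} θ)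
    (hD : B ∈ D) (hμ : HasCof D μ) : Q ∈ D.bind F ∧ HasCof (D.bind F) μ := by
  have hbind : ∀ S, S ∈ D.bind F ↔ ∀ᶠ θ in D, S ∈ F θ := fun S => Iff.rfl
  have hQD : Q ∈ D.bind F := (hbind Q).2 (by filter_upwards [hD] with θ h using (hF θ h).1)
  have hreg : ∀ θ ∈ B, θ.IsRegular := fun θ h => (hF θ h).2.regular (hF θ h).1 hQ.aleph0_le
  have hz : ∀ θ ∈ B, θ ≠ 0 := fun θ h => (hreg θ h).ne_zero
  obtain ⟨θ₀, hθ₀⟩ := D.nonempty_of_mem hD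
  obtain ⟨ν, hν⟩ := Cardinal.mem_range_lift_of_le (hB θ₀ hθ₀).le
  have hνθ : ∀ θ ∈ B, Order.succ ν ≤ θ := fun θ h =>
    Order.succ_le_iff.2 (Cardinal.lift_lt.1 (hν ▸ hB θ h))
  have hsc : ∀ θ, ∃ f : Ordinal.{u} → Cardinal.{u} → Ordinal.{u}, θ ∈ B →
      (∀ ξ < θ.ord, InProd Q (f ξ)) ∧ (∀ ξ < θ.ord, ∀ η ≤ ξ, f η ≤ᶠ[F θ] f ξ) ∧
        ∀ g, AEInProd (F θ) g → ∃ ξ < θ.ord, g ≤ᶠ[F θ] f ξ := fun θ => by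
    by_cases h : θ ∈ B
    · obtain ⟨f, hf⟩ := hQ.exists_scale (hF θ h).1 (hF θ h).2
      exact ⟨f, fun _ => hf⟩
    · exact ⟨default, fun h' => absurd h' h⟩
  choose f hf using hsc
  have hidx : ∀ g, InProd Q g → ∃ h, InProd B h ∧ ∀ θ ∈ B, g ≤ᶠ[F θ] f θ (h θ) := by
    intro g hg
    have : ∀ θ, ∃ ξ, θ ∈ B → ξ < θ.ord ∧ g ≤ᶠ[F θ] f θ ξ := fun θ => by
      by_cases h : θ ∈ B
      · obtain ⟨ξ, h1, h2⟩ := (hf θ h).2.2 g (hg.ae (hF θ h).1)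
        exact ⟨ξ, fun _ => ⟨h1, h2⟩⟩
      · exact ⟨0, fun h' => absurd h' h⟩
    choose h hh using this
    exact ⟨h, fun θ hθ => (hh θ hθ).1, fun θ hθ => (hh θ hθ).2⟩
  have hup : ∀ h, InProd B h → ∃ e, InProd Q e ∧ ∀ θ ∈ B, f θ (h θ) ≤ᶠ[F θ] e := by
    intro h hh
    obtain ⟨e, he, hle⟩ := hQ.exists_leMod_bound (lam := Order.succ ν) (ι := B)
      (by rw [← hν]; exact Cardinal.lift_lt.2 (Order.lt_succ ν)) (fun θ => f θ (h θ))
      fun θ => (hf θ θ.2).1 _ (hh θ θ.2)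
    exact ⟨e, he, fun θ hθ => hle ⟨θ, hθ⟩ _ (hF θ hθ).1 ((hF θ hθ).2.1.mono (hνθ θ hθ))⟩
  have htrans : ∀ g h k e : Cardinal.{u} → Ordinal.{u}, InProd B k →
      (∀ θ ∈ B, g ≤ᶠ[F θ] f θ (h θ)) → h ≤ᶠ[D] k → (∀ θ ∈ B, f θ (k θ) ≤ᶠ[F θ] e) →
      g ≤ᶠ[D.bind F] e := by
    intro g h k e hk h1 h2 h3
    refine (hbind _).2 ?_
    filter_upwards [hD, h2] with θ hθ h4
    exact (h1 θ hθ).trans (((hf θ hθ).2.1 _ (hk θ hθ) _ h4).trans (h3 θ hθ))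
  refine ⟨hQD, ?_, ?_⟩
  · intro m hm G hG
    have hG' : ∀ ξ : Iio m.ord, ∃ g, InProd Q g ∧ G ξ =ᶠ[D.bind F] g :=
      fun ξ => (hG ξ ξ.2).exists_inProd hQ.ne_zero
    choose g hg hGg using hG'
    choose h hh hgh using fun ξ => hidx (g ξ) (hg ξ)
    obtain ⟨k, hk, hhk⟩ := hμ.1.exists_bound (ι := Iio m.ord)
      (by rw [mk_Iio_ord]; exact Cardinal.lift_lt.2 hm) h fun ξ => (hh ξ).ae hD
    obtain ⟨k', hk', hkk⟩ := hk.exists_inProd hz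
    obtain ⟨e, he, hke⟩ := hup k' hk'
    exact ⟨e, he.ae hQD, fun ξ hξ => (hGg ⟨ξ, hξ⟩).le.trans
      (htrans _ _ _ _ hk' (hgh ⟨ξ, hξ⟩) ((hhk ⟨ξ, hξ⟩).trans hkk.le) hke)⟩
  · obtain ⟨K, hK, hcof⟩ := hμ.2
    have hK' : ∀ ξ, ∃ e, ξ < μ.ord → InProd Q e ∧ ∃ k, InProd B k ∧ K ξ =ᶠ[D] k ∧
        ∀ θ ∈ B, f θ (k θ) ≤ᶠ[F θ] e := fun ξ => by
      by_cases h : ξ < μ.ord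
      · obtain ⟨k, hk, hkk⟩ := (hK ξ h).exists_inProd hz
        obtain ⟨e, he, hke⟩ := hup k hk
        exact ⟨e, fun _ => ⟨he, k, hk, hkk, hke⟩⟩
      · exact ⟨default, fun h' => absurd h' h⟩
    choose e he using hK'
    refine ⟨e, fun ξ hξ => (he ξ hξ).1.ae hQD, fun g hg => ?_⟩
    obtain ⟨g', hg', hgg⟩ := hg.exists_inProd hQ.ne_zero
    obtain ⟨h, hh, hgh⟩ := hidx g' hg'
    obtain ⟨ξ, hξ, hle⟩ := hcof h (hh.ae hD)
    obtain ⟨-, k, hk, hkk, hke⟩ := he ξ hξ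
    exact ⟨ξ, hξ, hgg.le.trans (htrans _ _ _ _ hk hgh (hle.trans hkk.le) hke)⟩

/-- Possible cofinalities of a small set of possible cofinalities. -/
theorem Progressive.possCof_subset (hQ : Progressive σ Q) {B : Set Cardinal.{u}}
    (hBQ : B ⊆ PossCof Q) (hB : ∀ θ ∈ B, #B < Cardinal.lift.{u + 1} θ) :
    PossCof B ⊆ PossCof Q := by
  classical
  rintro μ ⟨D, hD, hμ⟩
  have : ∀ θ, ∃ U : Ultrafilter Cardinal.{u}, θ ∈ B → Q ∈ U ∧ HasCof U θ := fun θ => by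
    by_cases h : θ ∈ B
    · obtain ⟨U, hU⟩ := hBQ h
      exact ⟨U, fun _ => hU⟩
    · exact ⟨D, fun h' => absurd h' h⟩
  choose F hF using this
  exact ⟨_, hQ.hasCof_bind hF hB hD hμ⟩

/-! ### Universal sequences -/

/-- An increasing sequence in the product of `Q`. -/
structure IncSeq (Q : Set Cardinal.{u}) (lam : Cardinal.{u})
    (f : Ordinal.{u} → Cardinal.{u} → Ordinal.{u}) : Prop where
  inProd : ∀ ξ < lam.ord, InProd Q (f ξ)
  lt : ∀ ξ < lam.ord, ∀ η < ξ, LeMod Q lam (f η) (f ξ)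

theorem IncSeq.le {f} (h : IncSeq Q lam f) {ξ η : Ordinal.{u}} (hξ : ξ < lam.ord) (hη : η ≤ ξ) :
    LeMod Q lam (f η) (f ξ) := by
  rcases hη.lt_or_eq with h1 | h1
  · exact h.lt ξ hξ η h1
  · rw [h1]
    exact leMod_of_forall fun a _ => le_rfl

/-- An increasing sequence which is cofinal modulo every ultrafilter of cofinality `lam`. -/
structure UniversalSeq (Q : Set Cardinal.{u}) (lam : Cardinal.{u})
    (f : Ordinal.{u} → Cardinal.{u} → Ordinal.{u}) : Prop extends IncSeq Q lam f where
  cofinal : ∀ U : Ultrafilter Cardinal.{u}, Q ∈ U → HasCof U lam → ∀ g, InProd Q g →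
    ∃ ξ < lam.ord, g ≤ᶠ[U] f ξ

namespace Progressive
variable (hQ : Progressive σ Q)
include hQ

theorem exists_leMod_bound_Iio {ξ : Ordinal.{u}} (hξ : ξ < lam.ord)
    (F : Ordinal.{u} → Cardinal.{u} → Ordinal.{u}) (hF : ∀ η < ξ, InProd Q (F η)) :
    ∃ g, InProd Q g ∧ ∀ η < ξ, LeMod Q lam (F η) g := by
  obtain ⟨g, hg, hle⟩ := hQ.exists_leMod_bound (mk_Iio_lt hξ) (fun η : Iio ξ => F η)
    fun η => hF η η.2
  exact ⟨g, hg, fun η hη => hle ⟨η, hη⟩⟩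

theorem exists_incSeq (k : Ordinal.{u} → Cardinal.{u} → Ordinal.{u})
    (hk : ∀ ξ < lam.ord, InProd Q (k ξ)) :
    ∃ f, IncSeq Q lam f ∧ ∀ ξ < lam.ord, ∀ a ∈ Q, k ξ a ≤ f ξ a := by
  obtain ⟨f, h1, h2, h3⟩ := exists_increasing (δ := lam.ord) lam
    (fun ξ hξ F hF => hQ.exists_leMod_bound_Iio hξ F hF) k hk
  exact ⟨f, ⟨h1, h3⟩, h2⟩

theorem exists_universalSeq (hlam : lam.IsRegular) (hσ : σ < lam) :
    ∃ f, UniversalSeq Q lam f := by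
  by_contra! hcon
  have hcon' : ∀ f, IncSeq Q lam f → ∃ U : Ultrafilter Cardinal.{u}, Q ∈ U ∧ HasCof U lam ∧
      (∃ g, InProd Q g ∧ ∀ ξ < lam.ord, f ξ ≤ᶠ[U] g) ∧
      ∃ s : Ordinal.{u} → Cardinal.{u} → Ordinal.{u}, (∀ ξ < lam.ord, InProd Q (s ξ)) ∧
        ∀ g, AEInProd U g → ∃ ξ < lam.ord, g ≤ᶠ[U] s ξ := by
    intro f hf
    by_contra! hno
    refine hcon f ⟨hf, fun U hU hc g hg => ?_⟩
    by_contra! hg'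
    obtain ⟨s, hs1, -, hs2⟩ := hQ.exists_scale hU hc
    obtain ⟨h, hh, hnot⟩ := hno U hU hc ⟨g, hg, fun ξ hξ => (le_total' _ _).resolve_right (hg' ξ hξ)⟩
      s hs1
    obtain ⟨ξ, hξ, hle⟩ := hs2 h hh
    exact hnot ξ hξ hle
  choose! U hU hc hex s hs using hcon'
  choose! g hg hfg using hex
  obtain ⟨f, hf⟩ := exists_seq (X := Ordinal.{u} → Cardinal.{u} → Ordinal.{u})
    (fun i F x => i < σ.ord → IncSeq Q lam x ∧ ∀ j < i, ∀ ξ < lam.ord, ∀ a ∈ Q,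
      max (F j ξ a) (s (F j) ξ a) ≤ x ξ a)
    (fun i F G x hFG h hi => by
      obtain ⟨h1, h2⟩ := h hi
      exact ⟨h1, fun j hj => hFG j hj ▸ h2 j hj⟩)
    (fun i F hF => by
      by_cases hi : i < σ.ord
      · have h1 := fun ξ (hξ : ξ < lam.ord) => hQ.inProd_iSup (mk_Iio_lt hi).le
          (fun (j : Iio i) a => max (F j ξ a) (s (F j) ξ a)) fun j =>
            inProd_max ((hF j j.2 (j.2.trans hi)).1.1 ξ hξ)
              ((hs _ (hF j j.2 (j.2.trans hi)).1).1 ξ hξ)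
        obtain ⟨x, hx, hle⟩ := hQ.exists_incSeq
          (fun ξ a => ⨆ j : Iio i, max (F j ξ a) (s (F j) ξ a)) fun ξ hξ => (h1 ξ hξ).1
        exact ⟨x, fun _ => ⟨hx, fun j hj ξ hξ a ha =>
          ((h1 ξ hξ).2 ⟨j, hj⟩ a).trans (hle ξ hξ a ha)⟩⟩
      · exact ⟨default, fun h => absurd h hi⟩)
  have hinc : ∀ i : Iio σ.ord, IncSeq Q lam (f i) := fun i => (hf i i.2).1
  obtain ⟨hh, hgle⟩ := hQ.inProd_iSup (ι := Iio σ.ord) (mk_Iio_ord σ).le (fun i => g (f i))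
    fun i => hg _ (hinc i)
  set h : Cardinal.{u} → Ordinal.{u} := fun a => ⨆ i : Iio σ.ord, g (f i) a with hdef
  have hexc : ∀ i : Iio σ.ord, ∃ ξ < lam.ord, (fun a => h a + 1) ≤ᶠ[U (f i)] s (f i) ξ := fun i =>
    (hs _ (hinc i)).2 _ ((hQ.inProd_add_one hh).ae (hU _ (hinc i)))
  choose ξ hξ hle using hexc
  obtain ⟨η, hη, hξη⟩ := exists_bound_of_regular hlam (ι := Iio σ.ord)
    (by rw [mk_Iio_ord]; exact Cardinal.lift_lt.2 hσ) ξ hξ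
  refine absurd hQ.mk_lt (not_lt.2 ?_)
  have := mk_le_of_strict_chain (ι := Iio σ.ord) Q (fun i => {a | f i η a ≤ h a}) ?_
  · simpa [mk_Iio_ord] using this
  intro i
  have hi1 : i.1 + 1 < σ.ord := add_one_lt_ord hQ.regular.1 i.2
  have hii : i.1 < i.1 + 1 := Order.lt_add_one_iff.2 le_rfl
  have h1 : f (i.1 + 1) (ξ i) ≤ᶠ[U (f i)] f (i.1 + 1) η :=
    (hinc ⟨_, hi1⟩).le hη (hξη i) _ (hU _ (hinc i)) (hc _ (hinc i)).1
  have h2 := hfg _ (hinc i) η hη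
  have h3 : ∀ᶠ a in U (f i), a ∈ Q := hU _ (hinc i)
  obtain ⟨a, ⟨h4, h5⟩, h6, h7⟩ := ((h1.and h2).and (h3.and (hle i))).exists
  refine ⟨a, h6, h5.trans (hgle i a), fun j hj => ?_⟩
  have h8 : h a < f (i.1 + 1) η a := by
    have h9 := (le_max_right _ _).trans ((hf _ hi1).2 i.1 hii (ξ i) (hξ i) a h6)
    exact (Order.add_one_le_iff.1 (h7.trans h9)).trans_le h4
  have h10 : f (i.1 + 1) η a ≤ f j η a := by
    rcases (Order.add_one_le_iff.2 (show i.1 < j.1 from hj)).lt_or_eq with h11 | h11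
    · exact (le_max_left _ _).trans ((hf j j.2).2 _ h11 η hη a h6)
    · rw [h11]
  exact not_le.2 (h8.trans_le h10)

end Progressive

/-! ### Closed unbounded sets -/

/-- `C` is closed and unbounded in `δ`. -/
structure IsClubIn (δ : Ordinal.{u}) (C : Set Ordinal.{u}) : Prop where
  unbounded : ∀ x < δ, ∃ y ∈ C, x < y ∧ y < δ
  closed : ∀ x < δ, x ≠ 0 → (∀ y < x, ∃ z ∈ C, y < z ∧ z < x) → x ∈ C

theorem IsClubIn.iInter {δ : Ordinal.{u}} (hδ : ℵ₀ < δ.cof) {ι : Type (u + 1)}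
    (hι : #ι < Cardinal.lift.{u + 1} δ.cof) {C : ι → Set Ordinal.{u}}
    (h : ∀ i, IsClubIn δ (C i)) : IsClubIn δ (⋂ i, C i) := by
  have hlim : Order.IsSuccLimit δ :=
    Ordinal.one_lt_cof_iff.1 (Cardinal.one_lt_aleph0.trans hδ)
  have hstep : ∀ x, ∃ o, x < δ → o < δ ∧ x < o ∧ ∀ i, ∃ z ∈ C i, x < z ∧ z < o := by
    intro x
    by_cases hx : x < δ
    · choose n hn1 hn2 hn3 using fun i => (h i).unbounded x hx
      obtain ⟨o, ho, hle⟩ := exists_bound_of_lt_cof hι n hn3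
      refine ⟨max o x + 1, fun _ => ⟨hlim.add_one_lt (max_lt ho hx),
        Order.lt_add_one_iff.2 (le_max_right _ _), fun i =>
        ⟨n i, hn1 i, hn2 i, Order.lt_add_one_iff.2 ((hle i).trans (le_max_left _ _))⟩⟩⟩
    · exact ⟨0, fun h => absurd h hx⟩
  choose step hstep using hstep
  refine ⟨fun x hx => ?_, fun x hx h0 hlimx => mem_iInter.2 fun i => (h i).closed x hx h0
    fun y hy => ?_⟩
  · have hlt : ∀ n : ℕ, step^[n] x < δ := fun n => by
      induction n with
      | zero => exact hx
      | succ n ih =>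
        rw [Function.iterate_succ_apply']
        exact (hstep _ ih).1
    have hsup : ⨆ n : ULift.{u + 1} ℕ, step^[n.down] x < δ :=
      iSup_lt_of_lt_cof (by
        rw [Cardinal.mk_uLift, Cardinal.mk_nat, Cardinal.lift_aleph0]
        exact Cardinal.aleph0_lt_lift.2 hδ) _ fun n => hlt n.down
    have hle : ∀ n : ℕ, step^[n] x ≤ ⨆ n : ULift.{u + 1} ℕ, step^[n.down] x := fun n =>
      Ordinal.le_iSup (fun n : ULift.{u + 1} ℕ => step^[n.down] x) ⟨n⟩
    have hx1 : x < ⨆ n : ULift.{u + 1} ℕ, step^[n.down] x :=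
      (hstep x hx).2.1.trans_le (hle 1)
    refine ⟨_, mem_iInter.2 fun i => (h i).closed _ hsup (ne_bot_of_gt hx1) fun y hy => ?_,
      hx1, hsup⟩
    obtain ⟨n, hn⟩ := Ordinal.lt_iSup_iff.1 hy
    obtain ⟨z, hz, h1, h2⟩ := (hstep _ (hlt n.down)).2.2 i
    refine ⟨z, hz, hn.trans h1, h2.trans_le ?_⟩
    have := hle (n.down + 1)
    rwa [Function.iterate_succ_apply'] at this
  · obtain ⟨z, hz, h1⟩ := hlimx y hy
    exact ⟨z, mem_iInter.1 hz i, h1⟩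

theorem IsClubIn.inter {δ : Ordinal.{u}} (hδ : ℵ₀ < δ.cof) {C E : Set Ordinal.{u}}
    (hC : IsClubIn δ C) (hE : IsClubIn δ E) : IsClubIn δ (C ∩ E) := by
  have h := IsClubIn.iInter hδ (ι := ULift.{u + 1} Bool)
    (C := fun b => cond b.down C E) ?_ ?_
  · convert h using 1
    ext x
    simp [ULift.forall, and_comm]
  · refine lt_of_lt_of_le ?_ (Cardinal.aleph0_le_lift.2 hδ.le)
    exact Cardinal.lt_aleph0_of_finite _
  · rintro ⟨_ | _⟩
    · exact hE
    · exact hC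

/-- `e` is strictly increasing, continuous and cofinal from `τ` to `δ`. -/
structure IsNormalTo (e : Ordinal.{u} → Ordinal.{u}) (τ δ : Ordinal.{u}) : Prop where
  lt : ∀ j < τ, e j < δ
  strictMono : ∀ j < τ, ∀ i < j, e i < e j
  cofinal : ∀ x < δ, ∃ j < τ, x < e j
  cont : ∀ j < τ, Order.IsSuccLimit j → ∀ x < e j, ∃ i < j, x < e i

namespace IsNormalTo

variable {e : Ordinal.{u} → Ordinal.{u}} {τ δ : Ordinal.{u}} (h : IsNormalTo e τ δ)
include h

theorem lt_iff {i j : Ordinal.{u}} (hi : i < τ) (hj : j < τ) : e i < e j ↔ i < j := by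
  refine ⟨fun hlt => ?_, h.strictMono j hj i⟩
  by_contra! hle
  rcases hle.lt_or_eq with h1 | h1
  · exact absurd hlt (h.strictMono i hi j h1).not_gt
  · exact hlt.ne (by rw [h1])

theorem isClubIn_image : IsClubIn δ (e '' Iio τ) := by
  refine ⟨fun x hx => ?_, fun x hx h0 hlim => ?_⟩
  · obtain ⟨j, hj, hlt⟩ := h.cofinal x hx
    exact ⟨_, ⟨j, hj, rfl⟩, hlt, h.lt j hj⟩
  · have hne : {j | j < τ ∧ x ≤ e j}.Nonempty :=
      let ⟨j, hj, hlt⟩ := h.cofinal x hx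
      ⟨j, hj, hlt.le⟩
    obtain ⟨hj, hxj⟩ := csInf_mem hne
    set j := sInf {j | j < τ ∧ x ≤ e j} with hjdef
    have hmin : ∀ i < j, e i < x := fun i hi => by
      by_contra! hle
      exact notMem_of_lt_csInf' hi ⟨hi.trans hj, hle⟩
    rcases hxj.lt_or_eq with hlt | heq
    · exfalso
      obtain ⟨_, ⟨k, hk, rfl⟩, hk0, hkx⟩ := hlim 0 (pos_iff_ne_zero.2 h0)
      have hkj : k < j := (h.lt_iff hk hj).1 (hkx.trans hlt)
      rcases Ordinal.zero_or_succ_or_isSuccLimit j with h1 | ⟨i, h1⟩ | h1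
      · rw [h1] at hkj
        exact absurd hkj not_lt_zero
      · have hij : i < j := by rw [← h1]; exact Order.lt_succ i
        obtain ⟨_, ⟨l, hl, rfl⟩, hl0, hlx⟩ := hlim _ (hmin i hij)
        have h2 := (h.lt_iff (hij.trans hj) hl).1 hl0
        have h3 := (h.lt_iff hl hj).1 (hlx.trans hlt)
        rw [← h1] at h3
        exact absurd (Order.lt_succ_iff.1 h3) (not_le.2 h2)
      · obtain ⟨i, hi, hlt'⟩ := h.cont j hj h1 x hlt
        exact absurd (hmin i hi) hlt'.not_gt
    · exact ⟨j, hj, heq.symm⟩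

theorem cof_eq (hτ : Order.IsSuccLimit τ) : δ.cof = τ.cof := by
  have hmono : StrictMono fun i : Iio τ => e i := fun i j hij => h.strictMono j j.2 i hij
  rw [← Ordinal.cof_iSup_Iio hmono hτ.isSuccPrelimit]
  congr 1
  refine le_antisymm ?_ (Ordinal.iSup_le fun i => (h.lt i i.2).le)
  by_contra! hlt
  obtain ⟨j, hj, hlt'⟩ := h.cofinal _ hlt
  exact absurd (Ordinal.le_iSup (fun i : Iio τ => e i) ⟨j, hj⟩) (not_le.2 hlt')

theorem isClubIn_preimage (hδ : ℵ₀ < δ.cof) {C : Set Ordinal.{u}}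
    (hC : IsClubIn δ C) : IsClubIn τ {j | e j ∈ C} := by
  refine ⟨fun j hj => ?_, fun j hj h0 hlim => ?_⟩
  · obtain ⟨_, ⟨hy, ⟨i, hi, rfl⟩⟩, hlt, -⟩ :=
      (hC.inter hδ h.isClubIn_image).unbounded _ (h.lt j hj)
    exact ⟨i, hy, (h.lt_iff hj hi).1 hlt, hi⟩
  · have hjl : Order.IsSuccLimit j := by
      rcases Ordinal.zero_or_succ_or_isSuccLimit j with h1 | ⟨i, h1⟩ | h1
      · exact absurd h1 h0
      · obtain ⟨z, -, h2, h3⟩ := hlim i (by rw [← h1]; exact Order.lt_succ i)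
        rw [← h1] at h3
        exact absurd (Order.lt_succ_iff.1 h3) (not_le.2 h2)
      · exact h1
    obtain ⟨z, -, -, hzj⟩ := hlim 0 (pos_iff_ne_zero.2 h0)
    refine hC.closed _ (h.lt j hj) (ne_bot_of_gt (h.strictMono j hj z hzj)) fun y hy => ?_
    obtain ⟨i, hi, hlt⟩ := h.cont j hj hjl y hy
    obtain ⟨k, hk, h2, h3⟩ := hlim i hi
    exact ⟨e k, hk, hlt.trans (h.strictMono k (h3.trans hj) i h2), h.strictMono j hj k h3⟩

end IsNormalTo

theorem isNormalTo_of_iSup {e N : Ordinal.{u} → Ordinal.{u}} {τ δ : Ordinal.{u}}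
    (he : ∀ i < τ, e i = ⨆ j : Iio i, N j) (hN : ∀ j < τ, e j < N j)
    (hδ : ∀ j < τ, e j < δ) (hcof : ∀ x < δ, ∃ j < τ, x < e j) : IsNormalTo e τ δ := by
  have hle : ∀ j < τ, ∀ i < j, N i ≤ e j := fun j hj i hi => by
    rw [he j hj]
    exact Ordinal.le_iSup (fun i : Iio j => N i) ⟨i, hi⟩
  refine ⟨hδ, fun j hj i hi => (hN i (hi.trans hj)).trans_le (hle j hj i hi), hcof,
    fun j hj hlim x hx => ?_⟩
  rw [he j hj] at hx
  obtain ⟨i, hi⟩ := Ordinal.lt_iSup_iff.1 hx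
  have h1 : i.1 + 1 < j := hlim.add_one_lt i.2
  exact ⟨_, h1, hi.trans_le (hle _ (h1.trans hj) _ (Order.lt_add_one_iff.2 le_rfl))⟩

/-- Every limit ordinal is the limit of a normal sequence of length its cofinality. -/
theorem exists_isNormalTo {δ : Ordinal.{u}} (hδ : Order.IsSuccLimit δ) :
    ∃ e, IsNormalTo e δ.cof.ord δ := by
  classical
  obtain ⟨f, hf⟩ := Ordinal.exists_isFundamentalSeq (o := δ) rfl
  let g : Ordinal.{u} → Ordinal.{u} := fun i => if h : i < δ.cof.ord then (f ⟨i, h⟩).1 else 0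
  have hg : ∀ i < δ.cof.ord, g i < δ := fun i hi => by
    simp only [g, dif_pos hi]
    exact (f ⟨i, hi⟩).2
  obtain ⟨e, he⟩ := exists_seq (X := Ordinal.{u})
    (fun i F x => x = ⨆ j : Iio i, (max (F j) (g j) + 1))
    (fun i F G x hFG h => by
      rw [h]
      exact iSup_congr fun j => by rw [hFG j j.2])
    (fun i F _ => ⟨_, rfl⟩)
  have hlim : Order.IsSuccLimit δ.cof.ord :=
    Cardinal.isSuccLimit_ord (Ordinal.aleph0_le_cof_iff.2 (Ordinal.one_lt_cof_iff.2 hδ))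
  have hlt : ∀ i < δ.cof.ord, e i < δ := by
    intro i
    induction i using WellFoundedLT.induction with
    | ind i ih =>
      intro hi
      rw [he i]
      exact iSup_lt_of_lt_cof (mk_Iio_lt hi) _ fun j => hδ.add_one_lt
        (max_lt (ih j j.2 (j.2.trans hi)) (hg j (j.2.trans hi)))
  refine ⟨e, isNormalTo_of_iSup (N := fun j => max (e j) (g j) + 1) (fun i _ => he i)
    (fun j _ => Order.lt_add_one_iff.2 (le_max_left _ _)) hlt fun x hx => ?_⟩
  obtain ⟨_, ⟨i, rfl⟩, hi⟩ := hf.isCofinal_range ⟨x, hx⟩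
  have h1 : i.1 + 1 < δ.cof.ord := hlim.add_one_lt i.2
  refine ⟨i.1 + 1, h1, lt_of_lt_of_le (b := (f i).1 + 1) (Order.lt_add_one_iff.2 hi) ?_⟩
  rw [he (i.1 + 1)]
  refine le_trans ?_ (Ordinal.le_iSup (fun j : Iio (i.1 + 1) => max (e j) (g j) + 1)
    ⟨i.1, mem_Iio.2 (Order.lt_add_one_iff.2 le_rfl)⟩)
  have h2 : g i.1 = (f i).1 := dif_pos i.2
  rw [← h2]
  gcongr
  exact le_max_right _ _

/-! ### Obedient universal sequences -/

/-- The sequence takes minimal values at points of cofinality `σ`. -/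
structure ObedientSeq (σ : Cardinal.{u}) (Q : Set Cardinal.{u}) (lam : Cardinal.{u})
    (f : Ordinal.{u} → Cardinal.{u} → Ordinal.{u}) : Prop extends UniversalSeq Q lam f where
  exists_club : ∀ δ < lam.ord, δ.cof = σ → ∃ C, IsClubIn δ C ∧
    ∀ α ∈ C, α < δ → ∀ a ∈ Q, f α a ≤ f δ a
  minimal : ∀ δ < lam.ord, δ.cof = σ → ∀ C, IsClubIn δ C → ∀ a ∈ Q, ∀ o,
    (∀ α ∈ C, α < δ → f α a ≤ o) → f δ a ≤ o

theorem Progressive.exists_obedientSeq (hQ : Progressive σ Q) (hlam : lam.IsRegular)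
    (hσ : σ < lam) : ∃ f, ObedientSeq σ Q lam f := by
  obtain ⟨g, hg⟩ := hQ.exists_universalSeq hlam hσ
  let T (F : Ordinal.{u} → Cardinal.{u} → Ordinal.{u}) (ξ : Ordinal.{u}) (a : Cardinal.{u}) :
    Set Ordinal.{u} := {o | ∃ C, IsClubIn ξ C ∧ ∀ α ∈ C, α < ξ → F α a ≤ o}
  have hTcongr : ∀ F G ξ a, (∀ η < ξ, F η = G η) → T F ξ a = T G ξ a := by
    intro F G ξ a h
    ext o
    refine exists_congr fun C => and_congr_right fun _ => forall_congr' fun α =>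
      forall_congr' fun _ => forall_congr' fun hα => ?_
    rw [h α hα]
  have hclub : ∀ (F : Ordinal.{u} → Cardinal.{u} → Ordinal.{u}) (ξ), ξ.cof = σ →
      (∀ a ∈ Q, IsLeast (T F ξ a) (sInf (T F ξ a))) →
      ∃ C, IsClubIn ξ C ∧ ∀ α ∈ C, α < ξ → ∀ a ∈ Q, F α a ≤ sInf (T F ξ a) := by
    intro F ξ hξ h
    choose C hC hle using fun a : Q => (h a a.2).1
    exact ⟨⋂ a, C a, IsClubIn.iInter (by rw [hξ]; exact hQ.aleph0_lt)
      (by rw [hξ]; exact hQ.mk_lt) hC, fun α hα hlt a ha => hle ⟨a, ha⟩ α (mem_iInter.1 hα _) hlt⟩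
  have hleast : ∀ (F : Ordinal.{u} → Cardinal.{u} → Ordinal.{u}) (ξ), ξ.cof = σ →
      (∀ η < ξ, InProd Q (F η)) → ∀ a ∈ Q, IsLeast (T F ξ a) (sInf (T F ξ a)) ∧
        sInf (T F ξ a) < a.ord := by
    intro F ξ hξ hF a ha
    have hlim : Order.IsSuccLimit ξ := Ordinal.one_lt_cof_iff.1
      (by rw [hξ]; exact Cardinal.one_lt_aleph0.trans hQ.aleph0_lt)
    obtain ⟨e, he⟩ := exists_isNormalTo hlim
    rw [hξ] at he
    obtain ⟨o, ho, hle⟩ := exists_bound_of_regular (hQ.mem_regular a ha) (ι := Iio σ.ord)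
      (by rw [mk_Iio_ord]; exact Cardinal.lift_lt.2 (hQ.lt_mem a ha)) (fun j => F (e j) a)
      fun j => hF _ (he.lt j j.2) a ha
    have hoT : o ∈ T F ξ a := by
      refine ⟨_, he.isClubIn_image, ?_⟩
      rintro _ ⟨j, hj, rfl⟩ -
      exact hle ⟨j, hj⟩
    exact ⟨⟨csInf_mem ⟨o, hoT⟩, fun x hx => csInf_le' hx⟩, (csInf_le' hoT).trans_lt ho⟩
  obtain ⟨f, hf⟩ := exists_seq (X := Cardinal.{u} → Ordinal.{u})
    (fun ξ F x => ξ < lam.ord → InProd Q x ∧ (∀ η < ξ, LeMod Q lam (F η) x) ∧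
      (ξ.cof ≠ σ → ∀ a ∈ Q, g ξ a ≤ x a) ∧ (ξ.cof = σ → x = fun a => sInf (T F ξ a)))
    (fun ξ F G x hFG h hξ => by
      obtain ⟨h1, h2, h3, h4⟩ := h hξ
      refine ⟨h1, fun η hη => hFG η hη ▸ h2 η hη, h3, fun hc => ?_⟩
      rw [h4 hc]
      funext a
      rw [hTcongr F G ξ a hFG])
    (fun ξ F hF => by
      by_cases hξ : ξ < lam.ord
      · have hF' : ∀ η < ξ, InProd Q (F η) := fun η hη => (hF η hη (hη.trans hξ)).1
        by_cases hc : ξ.cof = σ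
        · refine ⟨fun a => sInf (T F ξ a), fun _ => ⟨fun a ha => (hleast F ξ hc hF' a ha).2,
            fun η hη => ?_, fun h => absurd hc h, fun _ => rfl⟩⟩
          obtain ⟨C, hC, hle⟩ := hclub F ξ hc fun a ha => (hleast F ξ hc hF' a ha).1
          obtain ⟨α, hα, hηα, hαξ⟩ := hC.unbounded η hη
          exact ((hF α hαξ (hαξ.trans hξ)).2.1 η hηα).trans
            (leMod_of_forall (hle α hα hαξ))
        · obtain ⟨x, hx, hle⟩ := hQ.exists_leMod_bound_Iio hξ F hF'
          exact ⟨_, fun _ => ⟨inProd_max hx (hg.1.1 ξ hξ), fun η hη =>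
            (hle η hη).trans (leMod_of_forall fun a _ => le_max_left _ _),
            fun _ a _ => le_max_right _ _, fun h => absurd h hc⟩⟩
      · exact ⟨default, fun h => absurd h hξ⟩)
  have hinc : IncSeq Q lam f := ⟨fun ξ hξ => (hf ξ hξ).1, fun ξ hξ => (hf ξ hξ).2.1⟩
  refine ⟨f, ⟨⟨hinc, fun U hU hc k hk => ?_⟩, fun δ hδ hc => ?_, fun δ hδ hc C hC a ha o ho => ?_⟩⟩
  · obtain ⟨ξ, hξ, hle⟩ := hg.cofinal U hU hc k hk
    have h1 := add_one_lt_ord hlam.1 hξ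
    have h2 : (ξ + 1).cof ≠ σ := by
      rw [Ordinal.cof_add_one]
      exact (Cardinal.one_lt_aleph0.trans hQ.aleph0_lt).ne
    exact ⟨ξ + 1, h1, hle.trans ((hg.1.le h1 (Order.lt_add_one_iff.2 le_rfl).le U hU hc.1).trans
      (le_of_forall hU ((hf _ h1).2.2.1 h2)))⟩
  · have hF' : ∀ η < δ, InProd Q (f η) := fun η hη => (hf η (hη.trans hδ)).1
    rw [(hf δ hδ).2.2.2 hc]
    exact hclub f δ hc fun a ha => (hleast f δ hc hF' a ha).1
  · rw [(hf δ hδ).2.2.2 hc]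
    exact csInf_le' ⟨C, hC, ho⟩

/-! ### Club guessing -/

theorem sSup_inter_Iic_mem {δ γ : Ordinal.{u}} {E : Set Ordinal.{u}} (hE : IsClubIn δ E)
    (h0 : 0 ∈ E) (hγ : γ < δ) : sSup (E ∩ Iic γ) ∈ E := by
  have hbdd : BddAbove (E ∩ Iic γ) := ⟨γ, fun x hx => hx.2⟩
  have hle : sSup (E ∩ Iic γ) ≤ γ := csSup_le' fun x hx => hx.2
  by_contra hx
  refine hx (hE.closed _ (hle.trans_lt hγ) (fun h => hx (h ▸ h0)) fun y hy => ?_)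
  obtain ⟨z, hz, hyz⟩ := exists_lt_of_lt_csSup' hy
  exact ⟨z, hz.1, hyz, (le_csSup hbdd hz).lt_of_ne fun h => hx (h ▸ hz.1)⟩

theorem exists_limit_of_isClubIn {ρ : Cardinal.{u}} (hσ : σ.IsRegular) (hρ : ρ.IsRegular)
    (h : σ < ρ) {E : Set Ordinal.{u}} (hE : IsClubIn ρ.ord E) :
    ∃ δ < ρ.ord, δ.cof = σ ∧ ∀ y < δ, ∃ z ∈ E, y < z ∧ z < δ := by
  have hN : ∀ x, ∃ y, x < y ∧ (x < ρ.ord → y ∈ E ∧ y < ρ.ord) := fun x => by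
    by_cases hx : x < ρ.ord
    · obtain ⟨y, h1, h2, h3⟩ := hE.unbounded x hx
      exact ⟨y, h2, fun _ => ⟨h1, h3⟩⟩
    · exact ⟨x + 1, Order.lt_add_one_iff.2 le_rfl, fun h => absurd h hx⟩
  choose N hN1 hN2 using hN
  obtain ⟨e, he⟩ := exists_seq (X := Ordinal.{u}) (fun i F x => x = ⨆ j : Iio i, N (F j))
    (fun i F G x hFG h => by
      rw [h]
      exact iSup_congr fun j => by rw [hFG j j.2])
    (fun i F _ => ⟨_, rfl⟩)
  have hlt : ∀ i < ρ.ord, e i < ρ.ord := by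
    intro i
    induction i using WellFoundedLT.induction with
    | ind i ih =>
      intro hi
      rw [he i]
      exact iSup_lt_of_lt_cof (by rw [hρ.cof_ord]; exact mk_Iio_lt hi) _
        fun j => (hN2 _ (ih j j.2 (j.2.trans hi))).2
  have hle : ∀ i, ∀ j < i, N (e j) ≤ e i := fun i j hj => by
    rw [he i]
    exact Ordinal.le_iSup (fun j : Iio i => N (e j)) ⟨j, hj⟩
  have hex : ∀ x < e σ.ord, ∃ j < σ.ord, x < N (e j) := fun x hx => by
    rw [he] at hx
    obtain ⟨j, hj⟩ := Ordinal.lt_iSup_iff.1 hx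
    exact ⟨j, j.2, hj⟩
  have hsucc : ∀ j, N (e j) < e (j + 1 + 1) := fun j =>
    (hle (j + 1) j (Order.lt_add_one_iff.2 le_rfl)).trans_lt
      ((hN1 _).trans_le (hle _ _ (Order.lt_add_one_iff.2 le_rfl)))
  have hσρ : σ.ord < ρ.ord := Cardinal.ord_lt_ord.2 h
  have hsuccσ : ∀ j < σ.ord, N (e j) < e σ.ord := fun j hj =>
    (hle _ _ (Order.lt_add_one_iff.2 le_rfl)).trans_lt
      ((hN1 _).trans_le (hle _ _ (add_one_lt_ord hσ.1 hj)))
  have hnormal : IsNormalTo e σ.ord (e σ.ord) := isNormalTo_of_iSup (N := fun j => N (e j))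
    (fun i _ => he i) (fun j _ => hN1 _) (fun j hj => (hN1 _).trans_le (hle _ _ hj))
    fun x hx => by
      obtain ⟨j, hj, hx⟩ := hex x hx
      exact ⟨j + 1, add_one_lt_ord hσ.1 hj, hx.trans_le (hle _ _ (Order.lt_add_one_iff.2 le_rfl))⟩
  refine ⟨e σ.ord, hlt _ hσρ, ?_, fun y hy => ?_⟩
  · rw [hnormal.cof_eq (Cardinal.isSuccLimit_ord hσ.1), hσ.cof_ord]
  · obtain ⟨j, hj, hx⟩ := hex y hy
    exact ⟨_, (hN2 _ (hlt j (hj.trans hσρ))).1, hx, hsuccσ j hj⟩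

theorem exists_clubGuessing {ρ : Cardinal.{u}} (hσ : σ.IsRegular) (hρ : ρ.IsRegular)
    (h : Order.succ σ < ρ) : ∃ C : Ordinal.{u} → Set Ordinal.{u}, ∀ E, IsClubIn ρ.ord E →
      ∃ d < ρ.ord, C d ⊆ E ∧ C d ⊆ Iio ρ.ord ∧ Cardinal.lift.{u + 1} σ ≤ #(C d) := by
  by_contra! hcon
  choose D hD hDC using hcon
  have hσρ : σ < ρ := (Order.lt_succ σ).trans h
  have hladder : ∀ δ : Ordinal.{u}, ∃ e, Order.IsSuccLimit δ → IsNormalTo e δ.cof.ord δ := fun δ => by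
    by_cases hδ : Order.IsSuccLimit δ
    · obtain ⟨e, he⟩ := exists_isNormalTo hδ
      exact ⟨e, fun _ => he⟩
    · exact ⟨id, fun h => absurd h hδ⟩
  choose e he using hladder
  let C (E : Set Ordinal.{u}) (δ : Ordinal.{u}) : Set Ordinal.{u} :=
    (fun i => sSup (E ∩ Iic (e δ i))) '' Iio δ.cof.ord \ {0}
  obtain ⟨E, hE⟩ := exists_seq (X := Set Ordinal.{u})
    (fun α F x => x = ⋂ β : Iio α, ({0} ∪ D (C (F β))))
    (fun i F G x hFG h => by
      rw [h]
      exact iInter_congr fun j => by rw [hFG j j.2])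
    (fun i F _ => ⟨_, rfl⟩)
  have h0 : ∀ α, 0 ∈ E α := fun α => by
    rw [hE]
    exact mem_iInter.2 fun _ => Or.inl rfl
  have hanti : ∀ α, ∀ β ≤ α, E α ⊆ E β := fun α β hβ => by
    rw [hE α, hE β]
    exact fun x hx => mem_iInter.2 fun γ => mem_iInter.1 hx ⟨γ, lt_of_lt_of_le γ.2 hβ⟩
  have hρcof : ρ.ord.cof = ρ := hρ.cof_ord
  have hclub : ∀ α ≤ (Order.succ σ).ord, IsClubIn ρ.ord (E α) := fun α hα => by
    rw [hE α]
    refine IsClubIn.iInter (by rw [hρcof]; exact hσ.1.trans_lt hσρ)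
      (by rw [hρcof]; exact mk_Iio_lt (hα.trans_lt (Cardinal.ord_lt_ord.2 h)))
      fun β => ⟨fun x hx => ?_, fun x hx hx0 hlim => Or.inr ((hD _).closed x hx hx0 fun y hy => ?_)⟩
    · obtain ⟨y, h1, h2⟩ := (hD (C (E β))).unbounded x hx
      exact ⟨y, Or.inr h1, h2⟩
    · obtain ⟨z, h1 | h1, h2, h3⟩ := hlim y hy
      · rw [mem_singleton_iff.1 h1] at h2
        exact absurd h2 not_lt_zero
      · exact ⟨z, h1, h2, h3⟩
  obtain ⟨δ, hδρ, hδσ, hδlim⟩ := exists_limit_of_isClubIn hσ hρ hσρ (hclub _ le_rfl)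
  have hδ : Order.IsSuccLimit δ := Ordinal.one_lt_cof_iff.1
    (by rw [hδσ]; exact Cardinal.one_lt_aleph0.trans_le hσ.1)
  have heδ := he δ hδ
  have hsreg : (Order.succ σ).IsRegular := Cardinal.isRegular_succ hσ.1
  have hslim := Cardinal.isSuccLimit_ord hsreg.1
  have hstab : ∀ i : Iio δ.cof.ord, ∃ α < (Order.succ σ).ord, ∀ β < (Order.succ σ).ord, α ≤ β →
      sSup (E α ∩ Iic (e δ i)) = sSup (E β ∩ Iic (e δ i)) := fun i => by
    obtain ⟨α, hα, hmin⟩ := exists_minimalFor_of_wellFoundedLT (fun α => α < (Order.succ σ).ord)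
      (fun α => sSup (E α ∩ Iic (e δ i))) ⟨0, hslim.bot_lt⟩
    refine ⟨α, hα, fun β hβ hαβ => ?_⟩
    have hle : sSup (E β ∩ Iic (e δ i)) ≤ sSup (E α ∩ Iic (e δ i)) :=
      csSup_le_csSup' ⟨e δ i, fun x hx => hx.2⟩ (inter_subset_inter_left _ (hanti β α hαβ))
    exact le_antisymm (hmin hβ hle) hle
  choose α hα hαβ using hstab
  obtain ⟨α', hα', hle⟩ := exists_bound_of_regular hsreg (ι := Iio δ.cof.ord)
    (by rw [mk_Iio_ord, hδσ]; exact Cardinal.lift_lt.2 (Order.lt_succ σ)) α hα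
  have hα1 : α' + 1 < (Order.succ σ).ord := hslim.add_one_lt hα'
  refine absurd ?_ (hDC (C (E α')) δ hδρ ?_ ?_).not_ge
  · by_contra! hlt
    obtain ⟨o, ho, hb⟩ := exists_bound_of_lt_cof (δ := δ) (ι := C (E α') δ) (by rwa [hδσ])
      (fun x => x.1) (by
        rintro ⟨_, ⟨i, hi, rfl⟩, -⟩
        exact (csSup_le' fun x hx => hx.2 : _ ≤ e δ i).trans_lt (heδ.lt i hi))
    obtain ⟨z, hzE, hoz, hzδ⟩ := hδlim o ho
    obtain ⟨i, hi, hzi⟩ := heδ.cofinal z hzδ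
    have h1 : z ≤ sSup (E α' ∩ Iic (e δ i)) := le_csSup ⟨e δ i, fun x hx => hx.2⟩
      ⟨hanti _ _ hα'.le hzE, hzi.le⟩
    have h2 : sSup (E α' ∩ Iic (e δ i)) ∈ C (E α') δ :=
      ⟨⟨i, hi, rfl⟩, (ne_bot_of_gt (hoz.trans_le h1) : _)⟩
    exact absurd (hb ⟨_, h2⟩) (not_le.2 (hoz.trans_le h1))
  · rintro _ ⟨⟨i, hi, rfl⟩, hx0⟩
    have h1 : sSup (E α' ∩ Iic (e δ i)) = sSup (E (α' + 1) ∩ Iic (e δ i)) := by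
      rw [← hαβ ⟨i, hi⟩ α' hα' (hle _), hαβ ⟨i, hi⟩ _ hα1 ((hle _).trans
        (Order.lt_add_one_iff.2 le_rfl).le)]
    have h2 := sSup_inter_Iic_mem (hclub _ hα1.le) (h0 _) ((heδ.lt i hi).trans hδρ)
    rw [← h1, hE (α' + 1)] at h2
    exact (mem_iInter.1 h2 ⟨α', mem_Iio.2 (Order.lt_add_one_iff.2 le_rfl)⟩).resolve_left hx0
  · rintro _ ⟨⟨i, hi, rfl⟩, -⟩
    exact (csSup_le' fun x hx => hx.2 : _ ≤ e δ i).trans_lt ((heδ.lt i hi).trans hδρ)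

/-! ### Generators -/

theorem Progressive.exists_generator {ρ : Cardinal.{u}} {A : Set Cardinal.{u}}
    (hA : Progressive ρ A) (hσ : σ.IsRegular) (hσρ : Order.succ σ < ρ)
    (hAσ : #A < Cardinal.lift.{u + 1} σ) (hlam : lam ∈ PossCof A) :
    ∃ Y ⊆ A, (∀ V : Ultrafilter Cardinal.{u}, Y ∈ V → ¬ Directed V (Order.succ lam)) ∧
      ∀ U : Ultrafilter Cardinal.{u}, A ∈ U → HasCof U lam → Y ∈ U := by
  by_contra! hcon
  have hreg := hA.possCof_regular hlam
  have hρlam := hA.lt_possCof hlam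
  obtain ⟨f, hf⟩ := hA.exists_obedientSeq hreg hρlam
  obtain ⟨g, hg, hfg⟩ := hA.exists_leMod_bound (lam := Order.succ lam) (ι := Iio lam.ord)
    (by rw [mk_Iio_ord]; exact Cardinal.lift_lt.2 (Order.lt_succ lam)) (fun ξ => f ξ)
    fun ξ => hf.1.1.1 ξ ξ.2
  have hexc : ∀ k : Cardinal.{u} → Ordinal.{u}, ∃ γ < lam.ord, ∀ η < lam.ord,
      LeMod A lam k (f η) → ∃ U : Ultrafilter Cardinal.{u}, A ∈ U ∧ HasCof U lam ∧
        (∀ᶠ a in U, k a < g a + 1) ∧ ∀ᶠ a in U, g a + 1 ≤ f γ a := by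
    intro k
    by_cases hk : ∃ η < lam.ord, LeMod A lam k (f η)
    · obtain ⟨η, hη, hle⟩ := hk
      obtain ⟨U, hU, hc, hY⟩ := hcon (A ∩ {a | g a + 1 ≤ f η a}) inter_subset_left fun V hV hd => by
        have h1 := hfg ⟨η, hη⟩ V (mem_of_superset hV inter_subset_left) hd
        have h2 : ∀ᶠ a in V, g a + 1 ≤ f η a := mem_of_superset hV inter_subset_right
        obtain ⟨a, h3, h4⟩ := (h1.and h2).exists
        exact absurd (h4.trans h3) (by simp)
      obtain ⟨γ, hγ, hgγ⟩ := hf.1.cofinal U hU hc _ (hA.inProd_add_one hg)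
      refine ⟨γ, hγ, fun _ _ _ => ⟨U, hU, hc, ?_, hgγ⟩⟩
      rw [← Ultrafilter.compl_mem_iff_notMem] at hY
      filter_upwards [hY, hU, hle U hU hc.1] with a h1 h2 h3
      exact h3.trans_lt (not_le.1 fun h4 => h1 ⟨h2, h4⟩)
    · exact ⟨0, Cardinal.ord_pos.2 (pos_iff_ne_zero.2 hreg.ne_zero),
        fun η hη hle => absurd ⟨η, hη, hle⟩ hk⟩
  choose Γ hΓ hΓU using hexc
  obtain ⟨C, hC⟩ := exists_clubGuessing hσ hA.regular hσρ
  let k (F : Ordinal.{u} → Ordinal.{u}) (d i : Ordinal.{u}) (a : Cardinal.{u}) : Ordinal.{u} :=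
    ⨆ j : ↥(C d ∩ Iic i), f (F j) a
  have hsmall : ∀ d i, Small.{u} ↥(C d ∩ Iic i) := fun d i => small_subset inter_subset_right
  let N (F : Ordinal.{u} → Ordinal.{u}) (i : Ordinal.{u}) : Ordinal.{u} :=
    max (F i) (⨆ d : Iio ρ.ord, Γ (k F d i)) + 1
  obtain ⟨ζ, hζ⟩ := exists_seq (X := Ordinal.{u}) (fun i F x => x = ⨆ j : Iio i, N F j)
    (fun i F G x hFG h => by
      rw [h]
      refine iSup_congr fun j => ?_
      have h1 : ∀ d, k F d j = k G d j := fun d => by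
        funext a
        exact iSup_congr fun l => by rw [hFG l (l.2.2.trans_lt j.2)]
      simp only [N, hFG j j.2, h1])
    (fun i F _ => ⟨_, rfl⟩)
  have hlamcof : lam.ord.cof = lam := hreg.cof_ord
  have hρlam' : ρ.ord < lam.ord := Cardinal.ord_lt_ord.2 hρlam
  have hζlt : ∀ i < lam.ord, ζ i < lam.ord := by
    intro i
    induction i using WellFoundedLT.induction with
    | ind i ih =>
      intro hi
      rw [hζ i]
      exact iSup_lt_of_lt_cof (by rw [hlamcof]; exact mk_Iio_lt hi) _
        fun j => add_one_lt_ord hreg.1 (max_lt (ih j j.2 (j.2.trans hi))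
          (iSup_lt_of_lt_cof (by rw [hlamcof, mk_Iio_ord]; exact Cardinal.lift_lt.2 hρlam) _
            fun d => hΓ _))
  have hNle : ∀ i, ∀ j < i, N ζ j ≤ ζ i := fun i j hj => by
    rw [hζ i]
    exact Ordinal.le_iSup (fun j : Iio i => N ζ j) ⟨j, hj⟩
  have hNlt : ∀ j, ζ j < N ζ j := fun j => Order.lt_add_one_iff.2 (le_max_left _ _)
  have hnormal : IsNormalTo ζ ρ.ord (ζ ρ.ord) := isNormalTo_of_iSup (N := N ζ)
    (fun i _ => hζ i) (fun j _ => hNlt j) (fun j hj => (hNlt j).trans_le (hNle _ _ hj))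
    fun x hx => by
      rw [hζ] at hx
      obtain ⟨j, hj⟩ := Ordinal.lt_iSup_iff.1 hx
      exact ⟨j + 1, add_one_lt_ord hA.regular.1 j.2,
        hj.trans_le (hNle _ _ (Order.lt_add_one_iff.2 le_rfl))⟩
  have hδcof : (ζ ρ.ord).cof = ρ := by
    rw [hnormal.cof_eq (Cardinal.isSuccLimit_ord hA.regular.1), hA.regular.cof_ord]
  have hδlt := hζlt _ hρlam'
  obtain ⟨E, hE, hEle⟩ := hf.exists_club _ hδlt hδcof
  obtain ⟨d, hd, hCE, hCρ, hCσ⟩ := hC _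
    (hnormal.isClubIn_preimage (by rw [hδcof]; exact hA.aleph0_lt) hE)
  refine absurd hCσ (not_le.2 (lt_of_le_of_lt ?_ hAσ))
  have := mk_le_of_strict_chain (ι := C d) A (fun i => {a | k ζ d i a < g a + 1}) ?_
  · simpa using this
  intro i
  have hle : ∀ a ∈ A, k ζ d i a ≤ f (ζ ρ.ord) a := fun a ha => Ordinal.iSup_le fun j =>
    hEle _ (hCE j.2.1) (hnormal.lt _ (hCρ j.2.1)) a ha
  obtain ⟨U, hU, hc, h1, h2⟩ := hΓU _ _ hδlt (leMod_of_forall hle)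
  by_cases hne : (C d ∩ Ioi i.1).Nonempty
  · obtain ⟨hjC, hij⟩ := csInf_mem hne
    set j := sInf (C d ∩ Ioi i.1) with hj
    have h3 : Γ (k ζ d i) ≤ ζ j := by
      refine le_trans ?_ (hNle j i hij)
      refine (Ordinal.le_iSup (fun d : Iio ρ.ord => Γ (k ζ d i)) ⟨d, hd⟩).trans ?_
      exact (le_max_right _ _).trans (Order.lt_add_one_iff.2 le_rfl).le
    have h4 := hf.1.1.le ((hnormal.lt j (hCρ hjC)).trans hδlt) h3 U hU hc.1
    obtain ⟨a, ⟨h5, h6⟩, h7, h8⟩ := ((h1.and h2).and (h4.and hU)).exists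
    refine ⟨a, h8, h5, fun l hl h10 =>
      (show k ζ d l a < g a + 1 from h10).not_ge ?_⟩
    have h9 : j ≤ l := csInf_le' ⟨l.2, hl⟩
    exact (h6.trans h7).trans (Ordinal.le_iSup (fun j : ↥(C d ∩ Iic l.1) => f (ζ j) a) ⟨j, hjC, h9⟩)
  · obtain ⟨a, h5, h6⟩ := (h1.and hU).exists
    exact ⟨a, h6, h5, fun l hl => absurd ⟨l.1, l.2, hl⟩ hne⟩

/-! ### Chains of characteristic functions -/

theorem mk_prod_list_le {τ : Cardinal.{u}} (hσ : ℵ₀ ≤ σ) (hτ : τ ≤ σ) {j : Ordinal.{u}}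
    (hj : j < σ.ord) :
    #(Iio τ.ord × List (Iio j × Iio j)) ≤ Cardinal.lift.{u + 1} σ := by
  have hσ' : ℵ₀ ≤ Cardinal.lift.{u + 1} σ := Cardinal.aleph0_le_lift.2 hσ
  have h1 : #(Iio j × Iio j) ≤ Cardinal.lift.{u + 1} σ := by
    rw [Cardinal.mk_prod, Cardinal.lift_id]
    exact Cardinal.mul_le_of_le hσ' (mk_Iio_lt hj).le (mk_Iio_lt hj).le
  rw [Cardinal.mk_prod, Cardinal.lift_id, Cardinal.lift_id, mk_Iio_ord]
  exact Cardinal.mul_le_of_le hσ' (Cardinal.lift_le.2 hτ)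
    ((Cardinal.mk_list_le_max _).trans (max_le hσ' h1))

theorem exists_closed_chain {τ : Cardinal.{u}} (hσ : σ.IsRegular) (hτ : τ ≤ σ)
    {T : Set Cardinal.{u}} (hT : ∀ a ∈ T, a.IsRegular ∧ σ < a)
    (Ψ : Ordinal.{u} → Set Cardinal.{u} → (Cardinal.{u} → Ordinal.{u}) →
      Cardinal.{u} → Ordinal.{u})
    (hΨ : ∀ i Z t, InProd T t → InProd T (Ψ i Z t))
    (Z : (Ordinal.{u} → Cardinal.{u} → Ordinal.{u}) → Ordinal.{u} →
      List (Ordinal.{u} × Ordinal.{u}) → Set Cardinal.{u})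
    (hZ : ∀ F G i l, (∀ p ∈ l, F p.1 = G p.1 ∧ F p.2 = G p.2) → Z F i l = Z G i l) :
    ∃ s : Ordinal.{u} → Cardinal.{u} → Ordinal.{u},
      (∀ a ∈ T, IsNormalTo (fun j => s j a) σ.ord (s σ.ord a)) ∧ InProd T (s σ.ord) ∧
      (∀ j < σ.ord, InProd T (s j)) ∧
      ∀ i < τ.ord, ∀ j < σ.ord, ∀ l : List (Ordinal.{u} × Ordinal.{u}),
        (∀ p ∈ l, p.1 < j ∧ p.2 < j) → ∀ a, Ψ i (Z s i l) (s j) a ≤ s (j + 1) a := by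
  let c (j : Ordinal.{u}) (l : List (Iio j × Iio j)) : List (Ordinal.{u} × Ordinal.{u}) :=
    l.map fun p => (p.1.1, p.2.1)
  let N (s : Ordinal.{u} → Cardinal.{u} → Ordinal.{u}) (j : Ordinal.{u}) (a : Cardinal.{u}) :
      Ordinal.{u} :=
    max (s j a) (⨆ p : Iio τ.ord × List (Iio j × Iio j), Ψ p.1 (Z s p.1 (c j p.2)) (s j) a) + 1
  obtain ⟨s, hs⟩ := exists_seq (X := Cardinal.{u} → Ordinal.{u})
    (fun i F x => x = fun a => ⨆ j : Iio i, N F j a)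
    (fun i F G x hFG h => by
      rw [h]
      funext a
      refine iSup_congr fun j => ?_
      have h1 : ∀ (k : Ordinal.{u}) (l : List (Iio j.1 × Iio j.1)),
          Z F k (c j l) = Z G k (c j l) := fun k l => hZ F G k _ fun p hp => by
        obtain ⟨q, -, rfl⟩ := List.mem_map.1 hp
        exact ⟨hFG _ (lt_trans q.1.2 j.2), hFG _ (lt_trans q.2.2 j.2)⟩
      simp only [N, hFG j j.2, h1])
    (fun i F _ => ⟨_, rfl⟩)
  have hs' : ∀ i a, s i a = ⨆ j : Iio i, N s j a := fun i a => congrFun (hs i) a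
  have hσlt : ∀ a ∈ T, Cardinal.lift.{u + 1} σ < Cardinal.lift.{u + 1} a.ord.cof := fun a ha => by
    rw [(hT a ha).1.cof_ord]
    exact Cardinal.lift_lt.2 (hT a ha).2
  have hsT : ∀ i ≤ σ.ord, InProd T (s i) := by
    intro i
    induction i using WellFoundedLT.induction with
    | ind i ih =>
      intro hi a ha
      rw [hs']
      refine iSup_lt_of_lt_cof (lt_of_le_of_lt ?_ (hσlt a ha)) _ fun j => ?_
      · rw [Cardinal.mk_Iio_ordinal]
        exact Cardinal.lift_le.2 ((Ordinal.card_le_card hi).trans (Cardinal.card_ord σ).le)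
      · have hj : j.1 < σ.ord := lt_of_lt_of_le j.2 hi
        have hjT := ih j j.2 hj.le
        exact add_one_lt_ord (hT a ha).1.1 (max_lt (hjT a ha) (iSup_lt_of_lt_cof
          ((mk_prod_list_le hσ.1 hτ hj).trans_lt (hσlt a ha)) _ fun p => hΨ _ _ _ hjT a ha))
  have hNle : ∀ i, ∀ j < i, ∀ a, N s j a ≤ s i a := fun i j hj a => by
    rw [hs' i]
    exact Ordinal.le_iSup (fun j : Iio i => N s j a) ⟨j, hj⟩
  have hNlt : ∀ j a, s j a < N s j a := fun j a => Order.lt_add_one_iff.2 (le_max_left _ _)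
  refine ⟨s, fun a ha => isNormalTo_of_iSup (N := fun j => N s j a) (fun i _ => hs' i a)
    (fun j _ => hNlt j a) (fun j hj => (hNlt j a).trans_le (hNle _ _ hj a)) fun x hx => ?_,
    hsT _ le_rfl, fun j hj => hsT j hj.le, fun i hi j hj l hl a => ?_⟩
  · rw [hs'] at hx
    obtain ⟨j, hj⟩ := Ordinal.lt_iSup_iff.1 hx
    exact ⟨j + 1, add_one_lt_ord hσ.1 j.2, hj.trans_le (hNle _ _ (Order.lt_add_one_iff.2 le_rfl) a)⟩
  · have hl' : l ∈ range (c j) := by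
      rw [range_list_map]
      exact fun p hp => ⟨(⟨p.1, (hl p hp).1⟩, ⟨p.2, (hl p hp).2⟩), rfl⟩
    obtain ⟨l, rfl⟩ := hl'
    have hsm : Small.{u} (Iio τ.ord × List (Iio j × Iio j)) :=
      small_of_mk_lt ((mk_prod_list_le hσ.1 hτ hj).trans_lt (Cardinal.lift_lt.2 (Order.lt_succ σ)))
    refine le_trans ?_ (hNle (j + 1) j (Order.lt_add_one_iff.2 le_rfl) a)
    refine (Ordinal.le_iSup (fun p : Iio τ.ord × List (Iio j × Iio j) =>
      Ψ p.1 (Z s p.1 (c j p.2)) (s j) a) (⟨i, hi⟩, l)).trans ?_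
    exact (le_max_right _ _).trans (Order.lt_add_one_iff.2 le_rfl).le

theorem isClubIn_Ioi {δ x : Ordinal.{u}} (hδ : Order.IsSuccLimit δ) (hx : x < δ) :
    IsClubIn δ (Ioi x) := by
  refine ⟨fun y hy => ⟨max x y + 1, mem_Ioi.2 (Order.lt_add_one_iff.2 (le_max_left _ _)),
    Order.lt_add_one_iff.2 (le_max_right _ _), hδ.add_one_lt (max_lt hx hy)⟩, fun y _ h0 hlim => ?_⟩
  obtain ⟨z, hz, -, hzy⟩ := hlim 0 (pos_iff_ne_zero.2 h0)
  exact lt_trans hz hzy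

namespace ObedientSeq

variable {f s : Ordinal.{u} → Cardinal.{u} → Ordinal.{u}} (hf : ObedientSeq σ Q lam f)
  (hσ : σ.IsRegular) (hσ0 : ℵ₀ < σ)
  (hlam : IsNormalTo (fun j => s j lam) σ.ord (s σ.ord lam)) (hlt : s σ.ord lam < lam.ord)
include hf hσ hσ0 hlam hlt

theorem exists_index {j₀ : Ordinal.{u}} (hj₀ : j₀ < σ.ord) (hQσ : #Q < Cardinal.lift.{u + 1} σ)
    (hs : ∀ a ∈ Q, IsNormalTo (fun j => s j a) σ.ord (s σ.ord a)) :
    ∃ j < σ.ord, ∃ j' < σ.ord, j₀ ≤ j ∧ j + 1 ≤ j' ∧ ∀ a ∈ Q, f (s σ.ord lam) a < s σ.ord a →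
      f (s j' lam) a < s j a := by
  have hcof : (s σ.ord lam).cof = σ := by
    rw [hlam.cof_eq (Cardinal.isSuccLimit_ord hσ.1), hσ.cof_ord]
  obtain ⟨C, hC, hle⟩ := hf.exists_club _ hlt hcof
  have h1 : ∀ a : Q, ∃ j < σ.ord, f (s σ.ord lam) a < s σ.ord a →
      f (s σ.ord lam) a < s j a := fun a => by
    by_cases h : f (s σ.ord lam) a < s σ.ord a
    · obtain ⟨j, hj, hlt⟩ := (hs a a.2).cofinal _ h
      exact ⟨j, hj, fun _ => hlt⟩
    · exact ⟨0, (Cardinal.isSuccLimit_ord hσ.1).bot_lt, fun h' => absurd h' h⟩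
  choose k hk hk' using h1
  obtain ⟨j, hj, hj₀j, hkj⟩ : ∃ j < σ.ord, j₀ ≤ j ∧ ∀ a, k a ≤ j := by
    obtain ⟨j, hj, hkj⟩ := exists_bound_of_regular hσ hQσ k hk
    exact ⟨max j₀ j, max_lt hj₀ hj, le_max_left _ _, fun a => (hkj a).trans (le_max_right _ _)⟩
  obtain ⟨j', hj'C, hjj', hj'⟩ :=
    (hlam.isClubIn_preimage (by rwa [hcof]) hC).unbounded _ (add_one_lt_ord hσ.1 hj)
  refine ⟨j, hj, j', hj', hj₀j, hjj'.le, fun a ha h => ?_⟩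
  refine (hle _ hj'C (hlam.lt j' hj') a ha).trans_lt ((hk' ⟨a, ha⟩ h).trans_le ?_)
  rcases (hkj ⟨a, ha⟩).lt_or_eq with h2 | h2
  · exact ((hs a ha).strictMono j hj _ h2).le
  · rw [h2]

theorem le_limit {j₀ : Ordinal.{u}} (hj₀ : j₀ < σ.ord)
    (hs : ∀ a ∈ Q, IsNormalTo (fun j => s j a) σ.ord (s σ.ord a))
    (h : ∀ j < σ.ord, j₀ ≤ j → ∀ a ∈ Q, f (s j lam) a ≤ s (j + 1) a) :
    ∀ a ∈ Q, f (s σ.ord lam) a ≤ s σ.ord a := by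
  have hcof : (s σ.ord lam).cof = σ := by
    rw [hlam.cof_eq (Cardinal.isSuccLimit_ord hσ.1), hσ.cof_ord]
  have hcof0 : ℵ₀ < (s σ.ord lam).cof := by rwa [hcof]
  have hlim := Ordinal.one_lt_cof_iff.1 (Cardinal.one_lt_aleph0.trans hcof0)
  intro a ha
  refine hf.minimal _ hlt hcof _
    (hlam.isClubIn_image.inter hcof0 (isClubIn_Ioi hlim (hlam.lt j₀ hj₀))) a ha _ ?_
  rintro _ ⟨⟨j, hj, rfl⟩, hj'⟩ -
  exact (h j hj ((hlam.lt_iff hj₀ hj).1 hj').le a ha).trans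
    ((hs a ha).lt _ (add_one_lt_ord hσ.1 hj)).le

end ObedientSeq

/-- A universal sequence eventually dominates every function at the top of its support. -/
theorem UniversalSeq.exists_dominating (hQ : Progressive σ Q) {Z : Set Cardinal.{u}} (hZ : Z ⊆ Q)
    {f} (hf : UniversalSeq Q lam f) (hlam : lam ∈ PossCof Z) (hmax : ∀ μ ∈ PossCof Z, μ ≤ lam)
    {g} (hg : InProd Q g) : ∃ ξ < lam.ord, ∀ ξ' < lam.ord, ξ ≤ ξ' →
      ∀ V : Ultrafilter Cardinal.{u}, Z ∈ V → {a | f ξ' a < g a} ∈ V → ¬ Directed V lam := by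
  by_contra! hcon
  have hZp := hQ.mono hZ
  have hreg := hZp.possCof_regular hlam
  have h0 : (0 : Ordinal.{u}) < lam.ord := Cardinal.ord_pos.2 (pos_iff_ne_zero.2 hreg.ne_zero)
  have : Nonempty (Iio lam.ord) := ⟨⟨0, h0⟩⟩
  have hmono : ∀ V : Ultrafilter Cardinal.{u}, Z ∈ V → Directed V lam → ∀ ξ' < lam.ord, ∀ ξ ≤ ξ',
      {a | f ξ' a < g a} ∈ V → {a | f ξ a < g a} ∈ V := fun V hV hd ξ' hξ' ξ hξ h => by
    filter_upwards [h, hf.1.le hξ' hξ V (mem_of_superset hV hZ) hd] with a h1 h2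
    exact lt_of_le_of_lt h2 h1
  obtain ⟨U, hU, hUR⟩ := hZp.exists_limit_ultrafilter (ι := Iio lam.ord) (fun _ => lam)
    (fun ξ => {a | f ξ a < g a})
    (fun i j => by
      rcases le_total i.1 j.1 with h | h
      · exact ⟨j, fun V hV hd hR => ⟨⟨hd, hmono V hV hd j j.2 i h hR⟩, hd, hR⟩⟩
      · exact ⟨i, fun V hV hd hR => ⟨⟨hd, hR⟩, hd, hmono V hV hd i i.2 j h hR⟩⟩)
    (fun ξ => by
      obtain ⟨ξ', hξ', hle, V, hV, hR, hd⟩ := hcon ξ ξ.2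
      exact ⟨V, hV, hd, hmono V hV hd ξ' hξ' ξ hle hR⟩)
  obtain ⟨μ, hμ⟩ := exists_hasCof hU hZp.small hZp.ne_zero
  have hμlam : μ = lam := le_antisymm (hmax μ ⟨U, hU, hμ⟩)
    (hμ.le_of_directed (hUR ⟨0, h0⟩).1 hU hZp.aleph0_le)
  rw [hμlam] at hμ
  obtain ⟨ξ, hξ, hle⟩ := hf.cofinal U (mem_of_superset hU hZ) hμ g hg
  obtain ⟨a, h1, h2⟩ := (hle.and (hUR ⟨ξ, hξ⟩).2).exists
  exact absurd h2 (not_lt.2 h1)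

/-! ### Possible cofinalities admit no escaping sequences -/

/-- The part of `B` left over after removing, for each listed pair `(j', j)`, the set on which the
function of index `s j'` attached to the top cofinality already dominates `s j`. -/
def residue (f : Cardinal.{u} → Ordinal.{u} → Cardinal.{u} → Ordinal.{u})
    (m : Set Cardinal.{u} → Cardinal.{u}) (s : Ordinal.{u} → Cardinal.{u} → Ordinal.{u})
    (B : Set Cardinal.{u}) : List (Ordinal.{u} × Ordinal.{u}) → Set Cardinal.{u}
  | [] => B
  | p :: l => {a ∈ residue f m s B l |
      f (m (residue f m s B l)) (s p.1 (m (residue f m s B l))) a < s p.2 a}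

theorem residue_subset (f m s) (B : Set Cardinal.{u}) (l) : residue f m s B l ⊆ B := by
  induction l with
  | nil => exact Subset.rfl
  | cons p l ih => exact (sep_subset _ _).trans ih

theorem residue_congr (f m) (B : Set Cardinal.{u})
    (F G : Ordinal.{u} → Cardinal.{u} → Ordinal.{u}) (l : List (Ordinal.{u} × Ordinal.{u}))
    (h : ∀ p ∈ l, F p.1 = G p.1 ∧ F p.2 = G p.2) :
    residue f m F B l = residue f m G B l := by
  induction l with
  | nil => rfl
  | cons p l ih =>
    have h1 := ih fun q hq => h q (List.mem_cons_of_mem _ hq)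
    have h2 := h p List.mem_cons_self
    simp only [residue, h1, h2.1, h2.2]

/-- A bound for the pointwise combinations of the sequences attached to a set of cofinalities
below `lam`. -/
theorem Progressive.exists_bound_combinations (hQ : Progressive σ Q) {B : Set Cardinal.{u}}
    {ι : Type (u + 1)} (hι : #ι ≤ Cardinal.lift.{u + 1} σ) (θ : ι → Cardinal.{u})
    (hB : B = range θ) (hBQ : B ⊆ Q)
    (f : Cardinal.{u} → Ordinal.{u} → Cardinal.{u} → Ordinal.{u})
    (hfB : ∀ ν ∈ B, ∀ ξ < ν.ord, InProd Q (f ν ξ))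
    (hf : ∀ ν ∈ PossCof B, ∀ ξ < ν.ord, InProd Q (f ν ξ))
    (hlt : ∀ ν ∈ PossCof B, ν < lam) (hσlam : σ < lam) (hU : Q ∈ U) (hd : Directed U lam) :
    ∃ G, InProd Q G ∧ ∀ (Λ : Finset Cardinal.{u}) (t : Cardinal.{u} → Ordinal.{u}),
      (∀ ν ∈ Λ, ν ∈ PossCof B ∧ t ν < ν.ord) →
      ∀ᶠ a in U, (⨆ i, f (θ i) (Λ.sup fun ν => f ν (t ν) (θ i)) a) < G a := by
  classical
  have hBp := hQ.mono hBQ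
  obtain ⟨c, hc, hc0, hcB⟩ : ∃ c < lam, ℵ₀ ≤ c ∧ ∀ ν ∈ PossCof B, ν ≤ c := by
    rcases B.eq_empty_or_nonempty with h | h
    · refine ⟨σ, hσlam, hQ.aleph0_lt.le, fun ν hν => ?_⟩
      obtain ⟨V, hV, -⟩ := hν
      rw [h] at hV
      exact absurd hV V.empty_notMem
    · obtain ⟨c, hc, hmax⟩ := hBp.exists_max_possCof h
      exact ⟨c, hlt c hc, (hBp.possCof_regular hc).1, hmax⟩
  let S : Type (u + 1) := {p : Cardinal.{u} × Ordinal.{u} // p.1 ∈ PossCof B ∧ p.2 < p.1.ord}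
  have hc0' : ℵ₀ ≤ Cardinal.lift.{u + 1} c := Cardinal.aleph0_le_lift.2 hc0
  have hS : #S ≤ Cardinal.lift.{u + 1} c := by
    have h1 : #(Iio (c.ord + 1)) ≤ Cardinal.lift.{u + 1} c := by
      rw [Cardinal.mk_Iio_ordinal, Ordinal.card_add_one, Cardinal.card_ord,
        Cardinal.add_one_eq hc0]
    have h2 : #S ≤ #(Iio (c.ord + 1) × Iio (c.ord + 1)) := by
      refine Cardinal.mk_le_of_injective (f := fun p : S =>
        ((⟨p.1.1.ord, ?_⟩, ⟨p.1.2, ?_⟩) : Iio (c.ord + 1) × Iio (c.ord + 1))) ?_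
      · exact Order.lt_add_one_iff.2 (Cardinal.ord_le_ord.2 (hcB _ p.2.1))
      · exact Order.lt_add_one_iff.2 (p.2.2.le.trans (Cardinal.ord_le_ord.2 (hcB _ p.2.1)))
      · rintro ⟨⟨p1, p2⟩, hp⟩ ⟨⟨q1, q2⟩, hq⟩ h
        have h1 : p1.ord = q1.ord := congrArg (fun x => x.1.1) h
        have h2 : p2 = q2 := congrArg (fun x => x.2.1) h
        exact Subtype.ext (Prod.ext (Cardinal.ord_injective h1) h2)
    refine h2.trans ?_
    rw [Cardinal.mk_prod, Cardinal.lift_id]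
    exact Cardinal.mul_le_of_le hc0' h1 h1
  have hFS : #(Finset S) < Cardinal.lift.{u + 1} lam :=
    (Cardinal.mk_le_of_surjective List.toFinset_surjective).trans_lt
      ((Cardinal.mk_list_le_max S).trans_lt
        ((max_le hc0' hS).trans_lt (Cardinal.lift_lt.2 hc)))
  let e (h : Cardinal.{u} → Ordinal.{u}) (a : Cardinal.{u}) : Ordinal.{u} :=
    ⨆ i, f (θ i) (h (θ i)) a
  have he : ∀ Λ : Finset S, InProd Q (e fun b => Λ.sup fun p => f p.1.1 p.1.2 b) := fun Λ => by
    refine (hQ.inProd_iSup hι _ fun i => ?_).1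
    have hi : θ i ∈ B := hB ▸ mem_range_self i
    refine hfB _ hi _ ((Finset.sup_lt_iff ?_).2 fun p _ => hf _ p.2.1 _ p.2.2 _ (hBQ hi))
    exact Cardinal.ord_pos.2 (pos_iff_ne_zero.2 (hBp.ne_zero _ hi))
  obtain ⟨G, hG, hle⟩ := hd.exists_bound hFS _ fun Λ => (he Λ).ae hU
  obtain ⟨G', hG', hGG⟩ := (hG.add_one hU hQ.aleph0_le).exists_inProd hQ.ne_zero
  refine ⟨G', hG', fun Λ t hΛ => ?_⟩
  filter_upwards [hle (Λ.attach.image fun ν => ⟨(ν.1, t ν.1), hΛ ν.1 ν.2⟩), hGG] with a h1 h2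
  rw [← h2]
  refine Order.lt_add_one_iff.2 (le_trans (le_of_eq ?_) h1)
  refine iSup_congr fun i => ?_
  dsimp only
  rw [Finset.sup_image]
  congr 1
  exact (Finset.sup_attach Λ fun ν => f ν (t ν) (θ i)).symm

theorem exists_inProd_extension {T : Set Cardinal.{u}} (hT : ∀ a ∈ T, a ≠ 0)
    {g : Cardinal.{u} → Ordinal.{u}} (hg : InProd Q g) :
    ∃ x, InProd T x ∧ ∀ a ∈ Q, g a ≤ x a := by
  classical
  refine ⟨fun a => if a ∈ Q then g a else 0, fun a ha => ?_, fun a ha => by simp [ha]⟩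
  dsimp only
  split_ifs with h
  · exact hg a h
  · exact Cardinal.ord_pos.2 (pos_iff_ne_zero.2 (hT a ha))

theorem exists_inProd_at {T : Set Cardinal.{u}} (hT : ∀ a ∈ T, a ≠ 0) {ξ : Ordinal.{u}}
    (hξ : ξ < lam.ord) : ∃ x, InProd T x ∧ ξ ≤ x lam := by
  obtain ⟨x, hx, hle⟩ := exists_inProd_extension (Q := {lam}) (g := fun _ => ξ) hT
    (fun a ha => by rwa [mem_singleton_iff.1 ha])
  exact ⟨x, hx, hle lam rfl⟩

theorem exists_list_bound {δ : Ordinal.{u}} (hδ : Order.IsSuccLimit δ)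
    (l : List (Ordinal.{u} × Ordinal.{u})) (hl : ∀ p ∈ l, p.1 < δ ∧ p.2 < δ) :
    ∃ j < δ, ∀ p ∈ l, p.1 < j ∧ p.2 < j := by
  induction l with
  | nil => exact ⟨0, hδ.bot_lt, by simp⟩
  | cons p l ih =>
    obtain ⟨j, hj, hlt⟩ := ih fun q hq => hl q (List.mem_cons_of_mem _ hq)
    obtain ⟨h1, h2⟩ := hl p List.mem_cons_self
    refine ⟨max j (max p.1 p.2 + 1), max_lt hj (hδ.add_one_lt (max_lt h1 h2)), fun q hq => ?_⟩
    rcases List.mem_cons.1 hq with rfl | hq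
    · exact ⟨lt_max_of_lt_right (Order.lt_add_one_iff.2 (le_max_left _ _)),
        lt_max_of_lt_right (Order.lt_add_one_iff.2 (le_max_right _ _))⟩
    · exact ⟨lt_max_of_lt_left (hlt q hq).1, lt_max_of_lt_left (hlt q hq).2⟩

theorem Progressive.not_escaping {A : Set Cardinal.{u}} {τ : Cardinal.{u}}
    (hA : Progressive σ A) (hτσ : τ < σ) (hAτ : #A < Cardinal.lift.{u + 1} τ)
    (θ : Ordinal.{u} → Cardinal.{u}) (hθ : ∀ i < τ.ord, θ i ∈ PossCof A)
    (hesc : ∀ i < τ.ord, ∀ ν ∈ PossCof (θ '' Iio i), ν < θ i) : False := by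
  classical
  set Q : Set Cardinal.{u} := A ∪ θ '' Iio τ.ord with hQdef
  have hAQ : A ⊆ Q := subset_union_left
  have hσreg := hA.regular
  have hQ : Progressive σ Q := by
    refine ⟨hA.regular, hA.aleph0_lt, ?_, ?_, ?_⟩
    · refine (Cardinal.mk_union_le _ _).trans_lt (Cardinal.add_lt_of_lt
        (Cardinal.aleph0_le_lift.2 hA.aleph0_lt.le) hA.mk_lt (Cardinal.mk_image_le.trans_lt ?_))
      rw [mk_Iio_ord]
      exact Cardinal.lift_lt.2 hτσ
    · rintro _ (h | ⟨i, hi, rfl⟩)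
      · exact hA.mem_regular _ h
      · exact hA.possCof_regular (hθ i hi)
    · rintro _ (h | ⟨i, hi, rfl⟩)
      · exact hA.lt_mem _ h
      · exact hA.lt_possCof (hθ i hi)
  set T : Set Cardinal.{u} := {a | a.IsRegular ∧ σ < a} with hTdef
  have hT0 : ∀ a ∈ T, a ≠ 0 := fun a ha => ha.1.ne_zero
  have hQT : Q ⊆ T := fun a ha => ⟨hQ.mem_regular a ha, hQ.lt_mem a ha⟩
  have hPT : PossCof Q ⊆ T := fun a ha => ⟨hQ.possCof_regular ha, hQ.lt_possCof ha⟩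
  have hθQ : ∀ i < τ.ord, θ i ∈ PossCof Q := fun i hi => possCof_mono hAQ (hθ i hi)
  have hBQ : ∀ i < τ.ord, θ '' Iio i ⊆ Q := fun i hi =>
    (image_mono (Iio_subset_Iio hi.le)).trans subset_union_right
  have hfex : ∀ ν, ∃ f : Ordinal.{u} → Cardinal.{u} → Ordinal.{u}, ν ∈ PossCof Q →
      ObedientSeq σ Q ν f := fun ν => by
    by_cases h : ν ∈ PossCof Q
    · obtain ⟨f, hf⟩ := hQ.exists_obedientSeq (hQ.possCof_regular h) (hQ.lt_possCof h)
      exact ⟨f, fun _ => hf⟩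
    · exact ⟨default, fun h' => absurd h' h⟩
  choose f hf using hfex
  have hmex : ∀ Z : Set Cardinal.{u}, ∃ m, Z ⊆ Q → Z.Nonempty →
      m ∈ PossCof Z ∧ ∀ ν ∈ PossCof Z, ν ≤ m := fun Z => by
    by_cases h : Z ⊆ Q ∧ Z.Nonempty
    · obtain ⟨m, hm⟩ := (hQ.mono h.1).exists_max_possCof h.2
      exact ⟨m, fun _ _ => hm⟩
    · exact ⟨0, fun h1 h2 => absurd ⟨h1, h2⟩ h⟩
  choose m hm using hmex
  have hFex : ∀ i, ∃ U : Ultrafilter Cardinal.{u}, i < τ.ord → A ∈ U ∧ HasCof U (θ i) := fun i => by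
    by_cases h : i < τ.ord
    · obtain ⟨U, hU⟩ := hθ i h
      exact ⟨U, fun _ => hU⟩
    · exact ⟨pure 0, fun h' => absurd h' h⟩
  choose F hF using hFex
  have hFQ : ∀ i < τ.ord, Q ∈ F i := fun i hi => mem_of_superset (hF i hi).1 hAQ
  have hGex : ∀ i, ∃ G, i < τ.ord → InProd Q G ∧
      ∀ (Λ : Finset Cardinal.{u}) (t : Cardinal.{u} → Ordinal.{u}),
        (∀ ν ∈ Λ, ν ∈ PossCof (θ '' Iio i) ∧ t ν < ν.ord) →
        ∀ᶠ a in F i, (⨆ j : Iio i, f (θ j) (Λ.sup fun ν => f ν (t ν) (θ j)) a) < G a := fun i => by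
    by_cases h : i < τ.ord
    · obtain ⟨G, hG⟩ := hQ.exists_bound_combinations (lam := θ i) (ι := Iio i)
        ((mk_Iio_lt h).le.trans (Cardinal.lift_le.2 hτσ.le)) (fun j => θ j) (image_eq_range _ _)
        (hBQ i h) f
        (by
          rintro _ ⟨j, hj, rfl⟩ ξ hξ
          exact (hf _ (hθQ j (lt_trans hj h))).1.1.1 ξ hξ)
        (fun ν hν ξ hξ => (hf _ (possCof_mono (hBQ i h) hν)).1.1.1 ξ hξ)
        (hesc i h) (hA.lt_possCof (hθ i h)) (hFQ i h) (hF i h).2.1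
      exact ⟨G, fun _ => hG⟩
    · exact ⟨default, fun h' => absurd h' h⟩
  choose G hG using hGex
  have hΨex : ∀ (i : Ordinal.{u}) (Z : Set Cardinal.{u}) (t : Cardinal.{u} → Ordinal.{u}),
      ∃ r, InProd T t → InProd T r ∧ (Z ⊆ Q → Z.Nonempty →
        (∀ a ∈ Q, f (m Z) (t (m Z)) a ≤ r a) ∧ ∀ ξ < (m Z).ord, r (m Z) ≤ ξ →
          ∀ V : Ultrafilter Cardinal.{u}, Z ∈ V → {a | f (m Z) ξ a < t a} ∈ V →
            ¬ Directed V (m Z)) ∧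
        (i < τ.ord → (∀ a ∈ Q, G i a ≤ r a) ∧
          ∀ ξ < (θ i).ord, r (θ i) ≤ ξ → t ≤ᶠ[F i] f (θ i) ξ) := by
    intro i Z t
    by_cases ht : InProd T t
    · have h0 : InProd T fun _ => 0 := fun a ha =>
        Cardinal.ord_pos.2 (pos_iff_ne_zero.2 (hT0 a ha))
      obtain ⟨x, hx, hxZ⟩ : ∃ x, InProd T x ∧ (Z ⊆ Q → Z.Nonempty →
          (∀ a ∈ Q, f (m Z) (t (m Z)) a ≤ x a) ∧ ∀ ξ < (m Z).ord, x (m Z) ≤ ξ →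
            ∀ V : Ultrafilter Cardinal.{u}, Z ∈ V → {a | f (m Z) ξ a < t a} ∈ V →
              ¬ Directed V (m Z)) := by
        by_cases hZ : Z ⊆ Q ∧ Z.Nonempty
        · obtain ⟨hmZ, hmax⟩ := hm Z hZ.1 hZ.2
          have hmQ := possCof_mono hZ.1 hmZ
          obtain ⟨x₁, hx₁, hle₁⟩ := exists_inProd_extension hT0
            ((hf _ hmQ).1.1.1 (t (m Z)) (ht _ (hPT hmQ)))
          obtain ⟨ξ, hξ, hdom⟩ := (hf _ hmQ).1.exists_dominating hQ hZ.1 hmZ hmax (ht.mono hQT)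
          obtain ⟨x₂, hx₂, hle₂⟩ := exists_inProd_at hT0 hξ
          exact ⟨_, Progressive.inProd_max hx₁ hx₂, fun _ _ =>
            ⟨fun a ha => (hle₁ a ha).trans (le_max_left _ _), fun ξ' hξ' hle =>
              hdom ξ' hξ' ((hle₂.trans (le_max_right _ _)).trans hle)⟩⟩
        · exact ⟨_, h0, fun h1 h2 => absurd ⟨h1, h2⟩ hZ⟩
      obtain ⟨y, hy, hyi⟩ : ∃ y, InProd T y ∧ (i < τ.ord → (∀ a ∈ Q, G i a ≤ y a) ∧
          ∀ ξ < (θ i).ord, y (θ i) ≤ ξ → t ≤ᶠ[F i] f (θ i) ξ) := by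
        by_cases hi : i < τ.ord
        · obtain ⟨y₁, hy₁, hle₁⟩ := exists_inProd_extension hT0 (hG i hi).1
          have hfi := (hf _ (hθQ i hi)).1
          obtain ⟨ξ, hξ, hle⟩ := hfi.cofinal _ (hFQ i hi) (hF i hi).2 t (ht.mono hQT)
          obtain ⟨y₂, hy₂, hle₂⟩ := exists_inProd_at hT0 hξ
          exact ⟨_, Progressive.inProd_max hy₁ hy₂, fun _ =>
            ⟨fun a ha => (hle₁ a ha).trans (le_max_left _ _), fun ξ' hξ' hle' =>
              hle.trans (hfi.1.le hξ' ((hle₂.trans (le_max_right _ _)).trans hle') _ (hFQ i hi)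
                (hF i hi).2.1)⟩⟩
        · exact ⟨_, h0, fun h => absurd h hi⟩
      exact ⟨_, fun _ => ⟨Progressive.inProd_max hx hy,
        fun h1 h2 => ⟨fun a ha => ((hxZ h1 h2).1 a ha).trans (le_max_left _ _),
          fun ξ hξ hle => (hxZ h1 h2).2 ξ hξ ((le_max_left _ _).trans hle)⟩,
        fun hi => ⟨fun a ha => ((hyi hi).1 a ha).trans (le_max_right _ _),
          fun ξ hξ hle => (hyi hi).2 ξ hξ ((le_max_right _ _).trans hle)⟩⟩⟩
    · exact ⟨default, fun h => absurd h ht⟩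
  choose Ψ hΨ using hΨex
  obtain ⟨s, hs, hsT, hsjT, hsΨ⟩ := exists_closed_chain hσreg hτσ.le (T := T) (fun a ha => ha) Ψ
    (fun i Z t ht => (hΨ i Z t ht).1) (fun s i l => residue f m s (θ '' Iio i) l)
    (fun F G i l h => residue_congr f m _ F G l h)
  have hsQ : ∀ a ∈ Q, IsNormalTo (fun j => s j a) σ.ord (s σ.ord a) := fun a ha => hs a (hQT ha)
  have hle : ∀ a ∈ T, ∀ j < σ.ord, ∀ j' ≤ j, s j' a ≤ s j a := fun a ha j hj j' hj' => by
    rcases hj'.lt_or_eq with h | h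
    · exact ((hs a ha).strictMono j hj j' h).le
    · rw [h]
  have hσlim := Cardinal.isSuccLimit_ord hσreg.1
  have hcov : ∀ i < τ.ord, ∀ (μ : Cardinal.{u}) (l : List (Ordinal.{u} × Ordinal.{u})),
      (∀ p ∈ l, p.1 < σ.ord ∧ p.2 < σ.ord) → (residue f m s (θ '' Iio i) l).Nonempty →
      m (residue f m s (θ '' Iio i) l) = μ →
      ∃ Λ : Finset Cardinal.{u}, (∀ ν ∈ Λ, ν ∈ PossCof (θ '' Iio i) ∧
        ∀ a ∈ Q, f ν (s σ.ord ν) a ≤ s σ.ord a) ∧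
        ∀ a ∈ residue f m s (θ '' Iio i) l, ∃ ν ∈ Λ, s σ.ord a ≤ f ν (s σ.ord ν) a := by
    intro i hi μ
    induction μ using WellFoundedLT.induction with
    | ind μ ih =>
    intro l hl hne hmμ
    set Z := residue f m s (θ '' Iio i) l with hZ
    have hZB : Z ⊆ θ '' Iio i := residue_subset _ _ _ _ _
    have hZQ := hZB.trans (hBQ i hi)
    obtain ⟨hmZ, hmax⟩ := hm Z hZQ hne
    rw [hmμ] at hmZ hmax
    have hμQ := possCof_mono hZQ hmZ
    have hμT := hPT hμQ
    obtain ⟨j₀, hj₀, hlj₀⟩ := exists_list_bound hσlim l hl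
    have hstep : ∀ j < σ.ord, j₀ ≤ j → ∀ a, Ψ i Z (s j) a ≤ s (j + 1) a := fun j hj hjj =>
      hsΨ i hi j hj l fun p hp => ⟨(hlj₀ p hp).1.trans_le hjj, (hlj₀ p hp).2.trans_le hjj⟩
    have hbelow : ∀ a ∈ Q, f μ (s σ.ord μ) a ≤ s σ.ord a :=
      (hf μ hμQ).le_limit hσreg hA.aleph0_lt (hs μ hμT) (hsT μ hμT) hj₀ hsQ fun j hj hjj a ha => by
        have h1 := ((hΨ i Z (s j) (hsjT j hj)).2.1 hZQ hne).1 a ha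
        rw [hmμ] at h1
        exact h1.trans (hstep j hj hjj a)
    obtain ⟨j, hj, j', hj', hj₀j, hjj', hexc⟩ := (hf μ hμQ).exists_index hσreg hA.aleph0_lt
      (hs μ hμT) (hsT μ hμT) hj₀ hQ.mk_lt hsQ
    set Z' := residue f m s (θ '' Iio i) ((j', j) :: l) with hZ'
    have hZ'eq : Z' = {a ∈ Z | f μ (s j' μ) a < s j a} := by
      rw [hZ', residue, ← hZ, hmμ]
    have hZ'Z : Z' ⊆ Z := hZ'eq ▸ sep_subset _ _
    rcases Z'.eq_empty_or_nonempty with hemp | hne'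
    · refine ⟨{μ}, fun ν hν => ?_, fun a ha => ⟨μ, Finset.mem_singleton_self _, ?_⟩⟩
      · rw [Finset.mem_singleton.1 hν]
        exact ⟨possCof_mono hZB hmZ, hbelow⟩
      · by_contra! hlt
        have h1 : a ∈ Z' := hZ'eq ▸ ⟨ha, hexc a (hZQ ha) hlt⟩
        rw [hemp] at h1
        exact h1
    · have hlt : m Z' < μ := by
        by_contra! hge
        obtain ⟨V, hV, hcV⟩ := (hm Z' (hZ'Z.trans hZQ) hne').1
        have h1 := ((hΨ i Z (s j) (hsjT j hj)).2.1 hZQ hne).2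
        rw [hmμ] at h1
        refine h1 (s j' μ) (hsjT j' hj' μ hμT) ((hstep j hj hj₀j μ).trans (hle μ hμT j' hj' _ hjj'))
          V (mem_of_superset hV hZ'Z) (mem_of_superset hV ?_) (hcV.1.mono hge)
        rw [hZ'eq]
        exact fun a ha => ha.2
      obtain ⟨Λ, hΛ, hΛZ⟩ := ih (m Z') hlt ((j', j) :: l) (by
        rintro p (_ | ⟨_, hp⟩)
        · exact ⟨hj', hj⟩
        · exact hl p hp) hne' rfl
      refine ⟨insert μ Λ, fun ν hν => ?_, fun a ha => ?_⟩
      · rcases Finset.mem_insert.1 hν with rfl | hν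
        · exact ⟨possCof_mono hZB hmZ, hbelow⟩
        · exact hΛ ν hν
      · by_cases h1 : s σ.ord a ≤ f μ (s σ.ord μ) a
        · exact ⟨μ, Finset.mem_insert_self _ _, h1⟩
        · have haZ' : a ∈ Z' := hZ'eq ▸ ⟨ha, hexc a (hZQ ha) (not_le.1 h1)⟩
          obtain ⟨ν, hν, h2⟩ := hΛZ a haZ'
          exact ⟨ν, Finset.mem_insert_of_mem hν, h2⟩
  have hX : ∀ i < τ.ord, {a | s σ.ord a ≤ f (θ i) (s σ.ord (θ i)) a} ∈ F i := by
    intro i hi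
    have hT := hPT (hθQ i hi)
    by_contra hX
    rw [← Ultrafilter.compl_mem_iff_notMem] at hX
    obtain ⟨j, hj, j', hj', -, hjj', hexc⟩ := (hf _ (hθQ i hi)).exists_index hσreg hA.aleph0_lt
      (hs _ hT) (hsT _ hT) hσlim.bot_lt hQ.mk_lt hsQ
    have h1 := ((hΨ i (residue f m s (θ '' Iio i) []) (s j) (hsjT j hj)).2.2 hi).2 (s j' (θ i))
      (hsjT j' hj' _ hT) ((hsΨ i hi j hj [] (by simp) _).trans (hle _ hT j' hj' _ hjj'))
    obtain ⟨a, ⟨h2, h3⟩, h4⟩ := ((Filter.eventually_mem_set.2 hX).and (hFQ i hi) |>.and h1).exists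
    exact absurd h4 (not_le.2 (hexc a h3 (not_le.1 h2)))
  have hstab : ∃ i < τ.ord, ∀ a ∈ A, s σ.ord a ≤ f (θ i) (s σ.ord (θ i)) a →
      ∃ j < i, s σ.ord a ≤ f (θ j) (s σ.ord (θ j)) a := by
    by_contra! hcon
    refine absurd hAτ (not_lt.2 ?_)
    have := mk_le_of_strict_chain (ι := Iio τ.ord) A
      (fun i => {a | ∀ j < i.1, f (θ j) (s σ.ord (θ j)) a < s σ.ord a}) ?_
    · simpa [mk_Iio_ord] using this
    intro i
    obtain ⟨a, ha, h1, h2⟩ := hcon i i.2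
    exact ⟨a, ha, h2, fun j hj h3 => absurd h1 (not_le.2 (h3 i hj))⟩
  obtain ⟨i, hi, hstab⟩ := hstab
  have hne : (θ '' Iio i).Nonempty := by
    obtain ⟨a, h1, h2⟩ := (F i).nonempty_of_mem (inter_mem (hX i hi) (hF i hi).1)
    obtain ⟨j, hj, -⟩ := hstab a h2 h1
    exact ⟨_, j, hj, rfl⟩
  obtain ⟨Λ, hΛ, hΛB⟩ := hcov i hi _ [] (by simp) hne rfl
  have hsup : ∀ j < i, (Λ.sup fun ν => f ν (s σ.ord ν) (θ j)) = s σ.ord (θ j) := fun j hj => by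
    have hjB : θ j ∈ θ '' Iio i := ⟨j, hj, rfl⟩
    refine le_antisymm (Finset.sup_le fun ν hν => (hΛ ν hν).2 _ (hBQ i hi hjB)) ?_
    obtain ⟨ν, hν, h⟩ := hΛB _ hjB
    exact h.trans (Finset.le_sup (f := fun ν => f ν (s σ.ord ν) (θ j)) hν)
  obtain ⟨a, ⟨h1, h2⟩, h3⟩ := ((Filter.eventually_mem_set.2 (hX i hi)).and (hF i hi).1 |>.and
    ((hG i hi).2 Λ (s σ.ord) fun ν hν => ⟨(hΛ ν hν).1,
      hsT _ (hPT (possCof_mono (hBQ i hi) (hΛ ν hν).1))⟩)).exists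
  obtain ⟨j, hj, h4⟩ := hstab a h2 h1
  have h5 := Ordinal.le_iSup
    (fun j : Iio i => f (θ j) (Λ.sup fun ν => f ν (s σ.ord ν) (θ j)) a) ⟨j, hj⟩
  dsimp only at h5
  rw [hsup j hj] at h5
  have h6 := ((hΨ i (residue f m s (θ '' Iio i) []) (s 0) (hsjT 0 hσlim.bot_lt)).2.2 hi).1 a (hAQ h2)
  have h7 := hsΨ i hi 0 hσlim.bot_lt [] (by simp) a
  have h8 := (hsQ a (hAQ h2)).lt _ (add_one_lt_ord hσreg.1 hσlim.bot_lt)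
  exact absurd (h4.trans h5) (not_le.2 (h3.trans_le (h6.trans (h7.trans h8.le))))

/-! ### Localization -/

theorem hasCof_pure (h : lam.IsRegular) : HasCof (pure lam) lam := by
  refine ⟨fun ν hν F hF => ?_, fun ξ _ => ξ, fun ξ hξ => hξ, fun g hg => ⟨g lam, hg, le_refl (g lam)⟩⟩
  obtain ⟨o, ho, hle⟩ := exists_bound_of_regular h (ι := Iio ν.ord)
    (by rw [mk_Iio_ord]; exact Cardinal.lift_lt.2 hν) (fun ξ => F ξ lam) fun ξ => hF ξ ξ.2
  exact ⟨fun _ => o, ho, fun ξ hξ => hle ⟨ξ, hξ⟩⟩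

theorem mem_possCof_of_mem (h : lam.IsRegular) (hlam : lam ∈ Q) : lam ∈ PossCof Q :=
  ⟨pure lam, hlam, hasCof_pure h⟩

/-- Ultrafilters containing a finite set have trivial cofinalities. -/
theorem HasCof.mem_of_finite (h : HasCof U μ) (hfin : Q.Finite) (hQ : Q ∈ U)
    (hreg : ∀ q ∈ Q, q.IsRegular) : μ ∈ Q := by
  obtain ⟨q, hq, rfl⟩ := Ultrafilter.eq_pure_of_finite_mem hfin hQ
  rwa [h.unique (hasCof_pure (hreg q hq)) hQ fun q hq => (hreg q hq).1]

/-- A set of possible cofinalities can be shrunk so that there is no possible cofinality immediately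
below that of the ultrafilter. -/
theorem Progressive.exists_shrink {κ τ ρ : Cardinal.{u}} {A B : Set Cardinal.{u}}
    (hA : Progressive ρ A) (hκ : κ.IsRegular) (hκρ : Order.succ κ < ρ)
    (hAκ : #A < Cardinal.lift.{u + 1} κ) (hBA : B ⊆ PossCof A) (hB : Progressive τ B)
    (hU : B ∈ U) (hc : HasCof U μ) :
    ∃ B' ∈ U, B' ⊆ B ∧ (∀ ν ∈ PossCof B', ν ≤ μ) ∧
      ∀ ν ∈ PossCof B', ν < μ → ∃ ν' ∈ PossCof B', ν < ν' ∧ ν' < μ := by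
  let S : Set Cardinal.{u} := {η | ∃ B' ∈ U, B' ⊆ B ∧ (∀ ν ∈ PossCof B', ν ≤ μ) ∧
    ∀ ν ∈ PossCof B', ν < μ → ν < η}
  have hS : S.Nonempty := by
    obtain ⟨Z, hZ, hnd⟩ := hB.exists_mem_not_directed hU hc (Order.lt_succ μ)
    refine ⟨μ, B ∩ Z, inter_mem hU hZ, inter_subset_left, ?_, fun _ _ h => h⟩
    rintro ν ⟨V, hV, hcV⟩
    exact Order.lt_succ_iff.1 (lt_of_not_directed hcV
      (hnd V (mem_of_superset hV inter_subset_right) (mem_of_superset hV inter_subset_left)))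
  obtain ⟨B', hB'U, hB'B, hle, hlt⟩ := csInf_mem hS
  refine ⟨B', hB'U, hB'B, hle, fun ν hν hνμ => ?_⟩
  by_contra! hmax
  have hBsize : ∀ θ ∈ B, #B < Cardinal.lift.{u + 1} θ := fun θ hθ =>
    hB.mk_lt.trans (Cardinal.lift_lt.2 (hB.lt_mem θ hθ))
  have hνA : ν ∈ PossCof A := hA.possCof_subset hBA hBsize (possCof_mono hB'B hν)
  obtain ⟨Y, -, hYnd, hYmem⟩ := hA.exists_generator hκ hκρ hAκ hνA
  have hFex : ∀ θ, ∃ F : Ultrafilter Cardinal.{u}, θ ∈ B → A ∈ F ∧ HasCof F θ := fun θ => by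
    by_cases h : θ ∈ B
    · obtain ⟨F, hF⟩ := hBA h
      exact ⟨F, fun _ => hF⟩
    · exact ⟨U, fun h' => absurd h' h⟩
  choose F hF using hFex
  have hbind : ∀ (D : Ultrafilter Cardinal.{u}) (X : Set Cardinal.{u}),
      X ∈ D.bind F ↔ {θ | X ∈ F θ} ∈ D := fun _ _ => Iff.rfl
  have hYU : {θ | Y ∉ F θ} ∈ U := by
    by_contra hcon
    have h1 : {θ | Y ∈ F θ} ∈ U := by
      rw [← Ultrafilter.compl_mem_iff_notMem] at hcon
      exact mem_of_superset hcon fun θ h => not_not.1 h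
    exact hYnd _ ((hbind U Y).2 h1)
      ((hA.hasCof_bind hF hBsize hU hc).2.1.mono (Order.succ_le_iff.2 hνμ))
  have hmem : ν ∈ S := by
    refine ⟨B' ∩ {θ | Y ∉ F θ}, inter_mem hB'U hYU, inter_subset_left.trans hB'B,
      fun η hη => hle η (possCof_mono inter_subset_left hη), fun η hη hημ => ?_⟩
    have h1 : ¬ ν < η := fun h => (hmax η (possCof_mono inter_subset_left hη) h).not_gt hημ
    refine (not_lt.1 h1).lt_of_ne ?_
    rintro rfl
    obtain ⟨D, hD, hcD⟩ := hη
    obtain ⟨hAD, hcA⟩ := hA.hasCof_bind hF hBsize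
      (mem_of_superset hD (inter_subset_left.trans hB'B)) hcD
    obtain ⟨θ, h2, h3⟩ := D.nonempty_of_mem (inter_mem hD ((hbind D Y).1 (hYmem _ hAD hcA)))
    exact h2.2 h3
  exact absurd (csInf_le' hmem) (not_le.2 (hlt ν hν hνμ))

theorem mk_iUnion_le_of_le {ι α : Type v} {c : Cardinal.{v}} (hc : ℵ₀ ≤ c) (hι : #ι ≤ c)
    (C : ι → Set α) (hC : ∀ i, #(C i) ≤ c) : #(⋃ i, C i) ≤ c :=
  (Cardinal.mk_iUnion_le C).trans (Cardinal.mul_le_of_le hc hι (ciSup_le' hC))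

/-- The localization theorem, away from the first cardinals. -/
theorem localization {κ : Cardinal.{u}} (hκ : ℵ₀ ≤ κ) {A : Set Cardinal.{u}}
    (hAκ : #A ≤ Cardinal.lift.{u + 1} κ) (hAreg : ∀ a ∈ A, a.IsRegular)
    (hAlt : ∀ a ∈ A, Order.succ (Order.succ (Order.succ κ)) < a) (μ : Cardinal.{u}) :
    ∀ B ⊆ PossCof A, (∀ θ ∈ B, #B < Cardinal.lift.{u + 1} θ) → μ ∈ PossCof B →
      ∃ C ⊆ B, #C ≤ Cardinal.lift.{u + 1} κ ∧ μ ∈ PossCof C := by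
  have hκ1 : κ < Order.succ κ := Order.lt_succ κ
  have hκ2 : Order.succ κ < Order.succ (Order.succ κ) := Order.lt_succ _
  have hκ3 : Order.succ (Order.succ κ) < Order.succ (Order.succ (Order.succ κ)) := Order.lt_succ _
  have hr1 := Cardinal.isRegular_succ hκ
  have hr2 := Cardinal.isRegular_succ hr1.1
  have hr3 := Cardinal.isRegular_succ hr2.1
  have hA1 : #A < Cardinal.lift.{u + 1} (Order.succ κ) := hAκ.trans_lt (Cardinal.lift_lt.2 hκ1)
  have hA2 : Progressive (Order.succ (Order.succ κ)) A :=
    ⟨hr2, hκ.trans_lt (hκ1.trans hκ2), hA1.trans (Cardinal.lift_lt.2 hκ2), hAreg,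
      fun a ha => hκ3.trans (hAlt a ha)⟩
  have hA3 : Progressive (Order.succ (Order.succ (Order.succ κ))) A :=
    ⟨hr3, hA2.2.trans hκ3, hA2.3.trans (Cardinal.lift_lt.2 hκ3), hAreg, hAlt⟩
  have hκ' : ℵ₀ ≤ Cardinal.lift.{u + 1} κ := Cardinal.aleph0_le_lift.2 hκ
  have hκP : ∀ θ ∈ PossCof A, κ < θ := fun θ hθ =>
    hκ1.trans (hκ2.trans (hA2.lt_possCof hθ))
  induction μ using WellFoundedLT.induction with
  | ind μ ih =>
  rintro B hBA hBsize ⟨U, hU, hc⟩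
  by_contra! hcon
  obtain ⟨θ₀, hθ₀⟩ := U.nonempty_of_mem hU
  obtain ⟨β, hβ⟩ := Cardinal.mem_range_lift_of_le (hBsize θ₀ hθ₀).le
  set τ := Order.succ (max β κ) with hτ
  have hτreg : τ.IsRegular := Cardinal.isRegular_succ (hκ.trans (le_max_right _ _))
  have hτB : ∀ θ ∈ B, τ ≤ θ := fun θ hθ => Order.succ_le_iff.2
    (max_lt (Cardinal.lift_lt.1 (hβ ▸ hBsize θ hθ)) (hκP θ (hBA hθ)))
  have hBreg : ∀ θ ∈ B, θ.IsRegular := fun θ hθ => hA2.possCof_regular (hBA hθ)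
  have hsing : ∀ q ∈ B, {q} ∉ U := fun q hq hqU => by
    have h1 : μ ∈ ({q} : Set Cardinal.{u}) := hc.mem_of_finite (finite_singleton q) hqU
      (fun x hx => by rw [mem_singleton_iff.1 hx]; exact hBreg q hq)
    refine hcon {q} (singleton_subset_iff.2 hq) ?_ (mem_possCof_of_mem ?_ h1)
    · rw [Cardinal.mk_singleton]
      exact Cardinal.one_lt_aleph0.le.trans hκ'
    · rw [mem_singleton_iff.1 h1]
      exact hBreg q hq
  have hB₀U : B \ {τ} ∈ U := by
    by_cases h : τ ∈ B
    · exact inter_mem hU (Ultrafilter.compl_mem_iff_notMem.2 (hsing τ h))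
    · rwa [sdiff_singleton_eq_self h]
  have hB₀ : Progressive τ (B \ {τ}) := by
    refine ⟨hτreg, hκ.trans_lt ((le_max_right β κ).trans_lt (Order.lt_succ _)), ?_,
      fun q hq => hBreg q hq.1, fun q hq => (hτB q hq.1).lt_of_ne fun h => hq.2 h.symm⟩
    refine (Cardinal.mk_le_mk_of_subset sdiff_subset).trans_lt ?_
    rw [← hβ]
    exact Cardinal.lift_lt.2 ((le_max_left β κ).trans_lt (Order.lt_succ _))
  obtain ⟨B', hB'U, hB'B₀, hle, hnomax⟩ := hA3.exists_shrink hr1 hκ3 hA1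
    (sdiff_subset.trans hBA) hB₀ hB₀U hc
  have hB'B : B' ⊆ B := hB'B₀.trans sdiff_subset
  have hB' : Progressive τ B' := hB₀.mono hB'B₀
  have hB'A : PossCof B' ⊆ PossCof A := (Progressive.possCof_mono hB'B).trans (hA2.possCof_subset hBA hBsize)
  have hbase : ∃ ν ∈ PossCof B', ν < μ := by
    by_contra! hge
    have hsub : B' ⊆ {μ} := fun q hq =>
      have hqP := mem_possCof_of_mem (hBreg q (hB'B hq)) hq
      (hle q hqP).antisymm (hge q hqP)
    obtain ⟨q, hq⟩ := U.nonempty_of_mem hB'U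
    have hμB : μ ∈ B := by
      rw [← mem_singleton_iff.1 (hsub hq)]
      exact hB'B hq
    exact hsing μ hμB (mem_of_superset hB'U hsub)
  have hnext : ∀ D : Set Cardinal.{u}, #D ≤ Cardinal.lift.{u + 1} κ →
      (∀ θ ∈ D, θ ∈ PossCof B' ∧ θ < μ) →
      ∃ x ∈ PossCof B', x < μ ∧ ∀ ν ∈ PossCof D, ν < x := by
    intro D hDκ hD
    have hDsize : ∀ θ ∈ D, #D < Cardinal.lift.{u + 1} θ := fun θ hθ =>
      hDκ.trans_lt (Cardinal.lift_lt.2 (hκP θ (hB'A (hD θ hθ).1)))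
    have hDB : PossCof D ⊆ PossCof B' := hB'.possCof_subset (fun θ hθ => (hD θ hθ).1) hDsize
    have hμD : μ ∉ PossCof D := by
      intro hμ
      have hloc : ∀ θ : D, ∃ C ⊆ B', #C ≤ Cardinal.lift.{u + 1} κ ∧ θ.1 ∈ PossCof C := fun θ =>
        ih θ (hD θ θ.2).2 B' (hB'B.trans hBA)
          (fun η hη => (Cardinal.mk_le_mk_of_subset hB'B).trans_lt (hBsize η (hB'B hη)))
          (hD θ θ.2).1
      choose C hCB hCκ hC using hloc
      have hCB' : ⋃ θ, C θ ⊆ B' := iUnion_subset hCB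
      refine hcon (⋃ θ, C θ) (hCB'.trans hB'B) (mk_iUnion_le_of_le hκ' hDκ C hCκ) ?_
      exact (hB'.mono hCB').possCof_subset
        (fun θ hθ => Progressive.possCof_mono (subset_iUnion C ⟨θ, hθ⟩) (hC ⟨θ, hθ⟩)) hDsize hμ
    rcases D.eq_empty_or_nonempty with h | h
    · obtain ⟨x, hx, hxμ⟩ := hbase
      refine ⟨x, hx, hxμ, fun ν hν => ?_⟩
      obtain ⟨V, hV, -⟩ := hν
      rw [h] at hV
      exact absurd hV V.empty_notMem
    · have hDp : Progressive (Order.succ κ) D :=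
        ⟨hr1, hκ.trans_lt hκ1, hDκ.trans_lt (Cardinal.lift_lt.2 hκ1),
          fun θ hθ => hB'.possCof_regular (hD θ hθ).1,
          fun θ hθ => hκ2.trans (hA2.lt_possCof (hB'A (hD θ hθ).1))⟩
      obtain ⟨ν, hν, hmax⟩ := hDp.exists_max_possCof h
      obtain ⟨x, hx, hνx, hxμ⟩ := hnomax ν (hDB hν)
        ((hle ν (hDB hν)).lt_of_ne fun h => hμD (h ▸ hν))
      exact ⟨x, hx, hxμ, fun η hη => (hmax η hη).trans_lt hνx⟩
  obtain ⟨θ, hθ⟩ := exists_seq (X := Cardinal.{u})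
    (fun i F x => i < (Order.succ κ).ord →
      x ∈ PossCof B' ∧ x < μ ∧ ∀ ν ∈ PossCof (F '' Iio i), ν < x)
    (fun i F G x hFG h hi => by
      have h1 : F '' Iio i = G '' Iio i := image_congr fun j hj => hFG j hj
      rw [← h1]
      exact h hi)
    (fun i F hF => by
      by_cases hi : i < (Order.succ κ).ord
      · obtain ⟨x, h1, h2, h3⟩ := hnext (F '' Iio i)
          (Cardinal.mk_image_le.trans (Order.lt_succ_iff.1
            (by rw [← Cardinal.lift_succ]; exact mk_Iio_lt hi)))
          (by
            rintro _ ⟨j, hj, rfl⟩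
            exact ⟨(hF j hj (lt_trans hj hi)).1, (hF j hj (lt_trans hj hi)).2.1⟩)
        exact ⟨x, fun _ => ⟨h1, h2, h3⟩⟩
      · exact ⟨0, fun h => absurd h hi⟩)
  exact hA2.not_escaping hκ2 hA1 θ (fun i hi => hB'A (hθ i hi).1) fun i hi => (hθ i hi).2.2

/-! ### Comparison with cofinalities of ultraproducts -/

theorem cof_cardinalUltraproduct {a : Set Cardinal.{u}} (hreg : ∀ q ∈ a, q.IsRegular)
    (F : Ultrafilter a) (h : HasCof (F.map Subtype.val) μ) :
    Order.cof (cardinalUltraproduct a F) = Cardinal.lift.{u + 1} μ := by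
  classical
  have haU : a ∈ F.map Subtype.val := Filter.mem_map.2 (by simp)
  let mk (f : Cardinal.{u} → Ordinal.{u}) (hf : InProd a f) : cardinalUltraproduct a F :=
    Quotient.mk'' fun i => ⟨f i, hf i i.2⟩
  have hmk : ∀ f g (hf : InProd a f) (hg : InProd a g), mk f hf ≤ mk g hg ↔
      f ≤ᶠ[F.map Subtype.val] g := fun f g hf hg => Iff.rfl
  have hsurj : ∀ x, ∃ f, ∃ hf : InProd a f, x = mk f hf := by
    intro x
    induction x using Quotient.inductionOn' with
    | h f =>
    refine ⟨fun c => if hc : c ∈ a then (f ⟨c, hc⟩).1 else 0, fun c hc => ?_, ?_⟩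
    · simp only [dif_pos hc]
      exact (f ⟨c, hc⟩).2
    · congr 1
      funext i
      exact Subtype.ext (by simp)
  have hz : ∀ q ∈ a, q ≠ 0 := fun q hq => (hreg q hq).ne_zero
  have hinf : ∀ q ∈ a, ℵ₀ ≤ q := fun q hq => (hreg q hq).1
  refine le_antisymm ?_ ?_
  · obtain ⟨G, hG, hcof⟩ := h.2
    choose g hg hGg using fun ξ : Iio μ.ord => (hG ξ ξ.2).exists_inProd hz
    have hc : IsCofinal (range fun ξ => mk (g ξ) (hg ξ)) := fun x => by
      obtain ⟨f, hf, rfl⟩ := hsurj x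
      obtain ⟨ξ, hξ, hle⟩ := hcof f (hf.ae haU)
      exact ⟨_, ⟨⟨ξ, hξ⟩, rfl⟩, (hmk _ _ _ _).2 (hle.trans (hGg ⟨ξ, hξ⟩).le)⟩
    exact (Order.cof_le hc).trans (Cardinal.mk_range_le.trans (mk_Iio_ord μ).le)
  · refine Order.le_cof_iff.2 fun S hS => ?_
    by_contra! hlt
    choose f hf hfx using hsurj
    obtain ⟨g, hg, hle⟩ := h.1.exists_bound hlt (fun x => f x) fun x => (hf x).ae haU
    obtain ⟨g', hg', hgg⟩ := (hg.add_one haU hinf).exists_inProd hz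
    obtain ⟨x, hx, hgx⟩ := hS (mk g' hg')
    rw [hfx x, hmk] at hgx
    exact not_add_one_le (hle ⟨x, hx⟩) (hgg.le.trans hgx)

theorem pcf_eq_possCof {a : Set Cardinal.{u}} (hreg : ∀ q ∈ a, q.IsRegular) (ha : Small.{u} a) :
    pcf a = PossCof a := by
  ext μ
  constructor
  · rintro ⟨F, hF⟩
    have haU : a ∈ F.map Subtype.val := Filter.mem_map.2 (by simp)
    obtain ⟨ν, hν⟩ := exists_hasCof haU ha fun q hq => (hreg q hq).ne_zero
    have h1 := cof_cardinalUltraproduct hreg F hν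
    rw [hF, Cardinal.lift_inj] at h1
    exact h1 ▸ ⟨_, haU, hν⟩
  · rintro ⟨U, hU, hc⟩
    have hrange : range (Subtype.val : a → Cardinal.{u}) ∈ U := by rwa [Subtype.range_val]
    refine ⟨U.comap Subtype.val_injective hrange, cof_cardinalUltraproduct hreg _ ?_⟩
    have h1 : (U.comap Subtype.val_injective hrange).map Subtype.val = U := by
      apply Ultrafilter.coe_injective
      rw [Ultrafilter.coe_map, Ultrafilter.coe_comap]
      exact Filter.map_comap_of_mem hrange
    rwa [h1]

theorem small_of_bounded {b : Set Cardinal.{u}}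
    (h : ∀ q ∈ b, #b < Cardinal.lift.{u + 1} q) : Small.{u} b := by
  rcases b.eq_empty_or_nonempty with rfl | ⟨q, hq⟩
  · infer_instance
  · exact small_of_mk_lt (h q hq)

/-- A set of cardinals above `κ` consists, up to a finite set, of cardinals large enough for the
localization theorem. -/
theorem exists_large_part {κ : Cardinal.{u}} {a : Set Cardinal.{u}}
    (hκ : #a = Cardinal.lift.{u + 1} κ) (hgt : ∀ q ∈ a, κ < q) :
    ∃ A ⊆ a, (a \ A).Finite ∧ (A.Nonempty → ℵ₀ ≤ κ ∧
      ∀ q ∈ A, Order.succ (Order.succ (Order.succ κ)) < q) := by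
  rcases lt_or_ge κ ℵ₀ with h | h
  · refine ⟨∅, empty_subset _, ?_, fun h => absurd h not_nonempty_empty⟩
    rw [sdiff_empty]
    exact Cardinal.lt_aleph0_iff_set_finite.1 (hκ ▸ Cardinal.lift_lt_aleph0.2 h)
  · refine ⟨{q ∈ a | Order.succ (Order.succ (Order.succ κ)) < q}, sep_subset _ _, ?_,
      fun _ => ⟨h, fun q hq => hq.2⟩⟩
    refine Set.Finite.subset (s := {Order.succ κ, Order.succ (Order.succ κ),
      Order.succ (Order.succ (Order.succ κ))}) (by simp) fun q hq => ?_
    have h1 : q ≤ Order.succ (Order.succ (Order.succ κ)) := not_lt.1 fun h => hq.2 ⟨hq.1, h⟩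
    have h2 := Order.succ_le_iff.2 (hgt q hq.1)
    rcases h2.eq_or_lt with h3 | h3
    · exact Or.inl h3.symm
    rcases (Order.succ_le_iff.2 h3).eq_or_lt with h4 | h4
    · exact Or.inr (Or.inl h4.symm)
    · exact Or.inr (Or.inr (h1.antisymm (Order.succ_le_iff.2 h4)))

theorem localization_of_lt {κ : Cardinal.{u}} {a b : Set Cardinal.{u}}
    (hκ : #a = Cardinal.lift.{u + 1} κ) (hreg : ∀ q ∈ a, q.IsRegular) (hgt : ∀ q ∈ a, κ < q)
    (hb : b ⊆ PossCof a) (hbgt : ∀ q ∈ b, #b < Cardinal.lift.{u + 1} q) (hμ : μ ∈ PossCof b) :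
    μ ∈ PossCof a ∧ ∃ c ⊆ b, #c ≤ Cardinal.lift.{u + 1} κ ∧ μ ∈ PossCof c := by
  obtain ⟨A, hAa, hfin, hA⟩ := exists_large_part hκ hgt
  obtain ⟨U, hU, hc⟩ := hμ
  have hsplit : ∀ (V : Ultrafilter Cardinal.{u}) (θ : Cardinal.{u}), a ∈ V → HasCof V θ →
      A ∈ V ∨ θ ∈ a \ A := fun V θ hV hθ => by
    by_cases hAV : A ∈ V
    · exact Or.inl hAV
    · exact Or.inr (hθ.mem_of_finite hfin (inter_mem hV (Ultrafilter.compl_mem_iff_notMem.2 hAV))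
        fun q hq => hreg q hq.1)
  by_cases hBU : b ∩ PossCof A ∈ U
  · obtain ⟨θ, -, V, hV, -⟩ := U.nonempty_of_mem hBU
    obtain ⟨hκ0, hlt⟩ := hA (V.nonempty_of_mem hV)
    have hBsize : ∀ θ ∈ b ∩ PossCof A, #↥(b ∩ PossCof A) < Cardinal.lift.{u + 1} θ := fun θ hθ =>
      (Cardinal.mk_le_mk_of_subset inter_subset_left).trans_lt (hbgt θ hθ.1)
    have hAκ : #A ≤ Cardinal.lift.{u + 1} κ := hκ ▸ Cardinal.mk_le_mk_of_subset hAa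
    have hAp : Progressive (Order.succ κ) A :=
      ⟨Cardinal.isRegular_succ hκ0, hκ0.trans_lt (Order.lt_succ κ),
        hAκ.trans_lt (Cardinal.lift_lt.2 (Order.lt_succ κ)), fun q hq => hreg q (hAa hq),
        fun q hq => (Order.lt_succ _).trans ((Order.lt_succ _).trans (hlt q hq))⟩
    refine ⟨Progressive.possCof_mono hAa (hAp.possCof_subset inter_subset_right hBsize
      ⟨U, hBU, hc⟩), ?_⟩
    obtain ⟨c, hcB, hcκ, hcμ⟩ := localization hκ0 hAκ (fun q hq => hreg q (hAa hq)) hlt μ _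
      inter_subset_right hBsize ⟨U, hBU, hc⟩
    exact ⟨c, hcB.trans inter_subset_left, hcκ, hcμ⟩
  · have hmem : b ∩ (a \ A) ∈ U := by
      filter_upwards [hU, Ultrafilter.compl_mem_iff_notMem.2 hBU] with θ h1 h2
      obtain ⟨V, hV, hθ⟩ := hb h1
      exact ⟨h1, (hsplit V θ hV hθ).resolve_left fun h3 => h2 ⟨h1, V, h3, hθ⟩⟩
    have hμ := hc.mem_of_finite (hfin.subset inter_subset_right) hmem fun q hq => hreg q hq.2.1
    have hμr := hreg μ hμ.2.1
    refine ⟨mem_possCof_of_mem hμr hμ.2.1, {μ}, singleton_subset_iff.2 hμ.1, ?_,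
      mem_possCof_of_mem hμr rfl⟩
    rw [Cardinal.mk_singleton, ← hκ]
    exact Cardinal.one_le_iff_ne_zero.2 (Cardinal.mk_ne_zero_iff.2 ⟨⟨μ, hμ.2.1⟩⟩)

end PcfTheory

theorem mainTheorem5 (κ : Cardinal.{u}) (a b : Set Cardinal.{u})
    (ha_card : Cardinal.mk a = Cardinal.lift.{u + 1} κ)
    (ha_reg : ∀ lam ∈ a, Cardinal.IsRegular lam)
    (ha_gt : ∀ lam ∈ a, κ < lam)
    (hb : b ⊆ pcf a)
    (hb_gt : ∀ lam ∈ b, Cardinal.mk b < Cardinal.lift.{u + 1} lam) :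
    pcf b ⊆ pcf a ∧
      ∀ μ ∈ pcf b, ∃ c : Set Cardinal.{u},
        c ⊆ b ∧ Cardinal.mk c ≤ Cardinal.lift.{u + 1} κ ∧ μ ∈ pcf c := by
  have ha_small : Small.{u} a :=
    PcfTheory.small_of_bounded fun q hq => ha_card ▸ Cardinal.lift_lt.2 (ha_gt q hq)
  have hb_small : Small.{u} b := PcfTheory.small_of_bounded hb_gt
  rw [PcfTheory.pcf_eq_possCof ha_reg ha_small] at hb ⊢
  have hb_reg : ∀ lam ∈ b, Cardinal.IsRegular lam := fun lam hlam =>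
    let ⟨_, hU, hc⟩ := hb hlam
    hc.regular hU fun q hq => (ha_reg q hq).1
  rw [PcfTheory.pcf_eq_possCof hb_reg hb_small]
  have hloc := fun μ hμ =>
    PcfTheory.localization_of_lt (μ := μ) ha_card ha_reg ha_gt hb hb_gt hμ
  refine ⟨fun μ hμ => (hloc μ hμ).1, fun μ hμ => ?_⟩
  obtain ⟨c, hcb, hcκ, hc⟩ := (hloc μ hμ).2
  refine ⟨c, hcb, hcκ, ?_⟩
  rwa [PcfTheory.pcf_eq_possCof (fun q hq => hb_reg q (hcb hq)) (small_subset hcb)]
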